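/- A partition of $n$ with designated summands is a partition of $n$ in which, for every part size that occurs, exactly one of the parts of that size is tagged. For every $k\ge 0$ let $\Delta_k$ be a bijection from the set of partitions of $k$ with designated summands onto the set of pairs $(\alpha,\beta)$ with $|\alpha|+|\beta|=k$, where $\alpha$ is an ordinary partition and $\beta$ is a partition into parts $\not\equiv\pm1\pmod 6$ (such bijections exist). A bipartition of $n$ with designated summands is an ordered pair $(\pi_1,\pi_2)$ of partitions with designated summands with $|\pi_1|+|\pi_2|=n$. Writing $\Delta_{|\pi_i|}(\pi_i)=(\alpha_i,\beta_i)$ for $i=1,2$, the $pd$-crank of $(\pi_1,\pi_2)$ is $\ell(\alpha_1)-\ell(\alpha_2)$, where $\ell(\alpha)$ is the number of parts of $\alpha$. (Empty partitions are allowed.) Let $M_{bd}(m,n)$ be the number of bipartitions of $n$ with designated summands whose $pd$-crank is $m$. Then for every integer $n\ge 0$ with $n\notin\{1,5,7\}$, the sequence $\{M_{bd}(m,n)\}_{|m|\le n}$ is symmetric and unimodal with peak at $m=0$: $M_{bd}(-m,n)=M_{bd}(m,n)$ for all integers $m$, and \[ M_{bd}(-n,n)\le\cdots\le M_{bd}(-1,n)\le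 M_{bd}(0,n)\ge M_{bd}(1,n)\ge\cdots\ge M_{bd}(n,n). \] -/

import Mathlib

/-- Partitions of `n` with designated summands: a partition `p` of `n` together with, for each
part size `i` occurring in `p`, a choice of exactly one of the `p.parts.count i` copies of `i`
(the tagged one). -/
abbrev DesignatedPartition (n : ℕ) : Type :=
  (p : n.Partition) × ((i : p.parts.toFinset) → Fin (p.parts.count (i : ℕ)))

/-- Vector partitions `(α, β)` with `|α| + |β| = n`, where `α` is an ordinary partition and `β` is
a partition into parts not congruent to `±1` modulo `6`. -/
abbrev VectorPartition (n : ℕ) : Type :=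
  (s : Finset.HasAntidiagonal.antidiagonal n) × (Nat.Partition (s : ℕ × ℕ).1 ×
    {β : Nat.Partition (s : ℕ × ℕ).2 //
      ∀ i ∈ β.parts, ¬ (i : ℤ) ≡ 1 [ZMOD 6] ∧ ¬ (i : ℤ) ≡ -1 [ZMOD 6]})

namespace VectorPartition

/-- The multiset of parts of the component `α` of `(α, β)`. -/
def alphaParts {n : ℕ} (v : VectorPartition n) : Multiset ℕ := v.2.1.parts

/-- The multiset of parts of the component `β` of `(α, β)`. -/
def betaParts {n : ℕ} (v : VectorPartition n) : Multiset ℕ := v.2.2.1.parts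

/-- A vector partition from its two multisets of parts. -/
def mk' {n : ℕ} (a b : Multiset ℕ) (ha : ∀ i ∈ a, 0 < i) (hb : ∀ i ∈ b, 0 < i)
    (hmod : ∀ i ∈ b, ¬ (i : ℤ) ≡ 1 [ZMOD 6] ∧ ¬ (i : ℤ) ≡ -1 [ZMOD 6])
    (hsum : a.sum + b.sum = n) : VectorPartition n :=
  ⟨⟨(a.sum, b.sum), by simpa using hsum⟩,
    ⟨a, fun {i} hi => ha i hi, rfl⟩, ⟨⟨b, fun {i} hi => hb i hi, rfl⟩, hmod⟩⟩

theorem ext_parts {n : ℕ} {v w : VectorPartition n} (ha : v.alphaParts = w.alphaParts)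
    (hb : v.betaParts = w.betaParts) : v = w := by
  obtain ⟨⟨⟨s, t⟩, hs⟩, ⟨a, a0, as⟩, ⟨⟨b, b0, bs⟩, hb'⟩⟩ := v
  obtain ⟨⟨⟨s', t'⟩, hs'⟩, ⟨a', a0', as'⟩, ⟨⟨b', b0', bs'⟩, hb''⟩⟩ := w
  simp only [alphaParts, betaParts] at ha hb
  subst ha hb
  simp only at as bs as' bs'
  subst as bs as' bs'
  rfl

end VectorPartition

/-- Bipartitions of `n` with designated summands: ordered pairs of partitions with designated
summands whose sizes add up to `n`. -/
abbrev DesignatedBipartition (n : ℕ) : Type :=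
  (s : Finset.HasAntidiagonal.antidiagonal n) ×
    (DesignatedPartition (s : ℕ × ℕ).1 × DesignatedPartition (s : ℕ × ℕ).2)

/-- The `pd`-crank of a bipartition `(π₁, π₂)` with designated summands, with respect to a
size-preserving bijection `Δ`: the number of parts of `α₁` minus the number of parts of `α₂`,
where `Δ(π₁) = (α₁, β₁)` and `Δ(π₂) = (α₂, β₂)`. -/
def pdCrank (Δ : ∀ k : ℕ, DesignatedPartition k ≃ VectorPartition k) {n : ℕ}
    (π : DesignatedBipartition n) : ℤ :=
  ((Δ _ π.2.1).alphaParts.card : ℤ) - ((Δ _ π.2.2).alphaParts.card : ℤ)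

/-- `Mbd Δ m n` is the number of bipartitions of `n` with designated summands whose `pd`-crank
is `m`. The cardinality is taken over a finite type. -/
def Mbd (Δ : ∀ k : ℕ, DesignatedPartition k ≃ VectorPartition k) (m : ℤ) (n : ℕ) : ℕ :=
  Fintype.card {π : DesignatedBipartition n // pdCrank Δ π = m}

/-! ### An explicit size-preserving bijection `Δ` -/

namespace DesignatedPartition

/-- The position (counted from `1`) of the tagged copy of `i`, and `0` if `i` is not a part. -/
def tagPos {n : ℕ} (p : DesignatedPartition n) (i : ℕ) : ℕ :=
  if h : i ∈ p.1.parts.toFinset then (p.2 ⟨i, h⟩ : ℕ) + 1 else 0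

theorem tagPos_le {n : ℕ} (p : DesignatedPartition n) (i : ℕ) :
    p.tagPos i ≤ p.1.parts.count i := by
  unfold tagPos
  split_ifs with h
  · exact (p.2 ⟨i, h⟩).isLt
  · exact Nat.zero_le _

theorem tagPos_pos {n : ℕ} (p : DesignatedPartition n) {i : ℕ} (h : i ∈ p.1.parts) :
    0 < p.tagPos i := by
  simp [tagPos, h]

theorem ext_tagPos {n : ℕ} {p q : DesignatedPartition n}
    (h1 : ∀ i, p.1.parts.count i = q.1.parts.count i) (h2 : ∀ i, p.tagPos i = q.tagPos i) :
    p = q := by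
  obtain ⟨p, t⟩ := p
  obtain ⟨q, u⟩ := q
  obtain rfl : p = q := Nat.Partition.ext (Multiset.ext.2 h1)
  congr 1
  funext ⟨i, hi⟩
  have := h2 i
  simp only [tagPos, hi, dif_pos] at this
  exact Fin.ext (by omega)

/-- The copies of `i` that go to `α`: all of them when the first copy is tagged, otherwise the
copies after the tagged one. -/
def outer {n : ℕ} (p : DesignatedPartition n) (i : ℕ) : ℕ :=
  if p.tagPos i ≤ 1 then p.1.parts.count i else p.1.parts.count i - p.tagPos i

/-- The copies of `i` that do not go to `α`; their number is never `1`. -/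
def inner {n : ℕ} (p : DesignatedPartition n) (i : ℕ) : ℕ :=
  if p.tagPos i ≤ 1 then 0 else p.tagPos i

theorem outer_add_inner {n : ℕ} (p : DesignatedPartition n) (i : ℕ) :
    p.outer i + p.inner i = p.1.parts.count i := by
  have := p.tagPos_le i
  unfold outer inner
  split_ifs <;> omega

theorem inner_ne_one {n : ℕ} (p : DesignatedPartition n) (i : ℕ) : p.inner i ≠ 1 := by
  unfold inner
  split_ifs <;> omega

end DesignatedPartition

/-- `c` copies of `i` (with `c ≠ 1`), rewritten with parts not congruent to `±1` modulo `6`: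
pairs of copies become parts `2 * i`; if `c` is odd, three copies are first merged to `3 * i`,
which is then split into `2 ^ k` copies of `3 * d`, where `i = 2 ^ k * d` with `d` odd. -/
def rewriteCopies (c i : ℕ) : Multiset ℕ :=
  Multiset.replicate ((c - 3 * (c % 2)) / 2) (2 * i) +
    Multiset.replicate ((c % 2) * ordProj[2] i) (3 * ordCompl[2] i)

theorem rewriteCopies_sum (c i : ℕ) (hc : c ≠ 1) : (rewriteCopies c i).sum = c * i := by
  have h := Nat.ordProj_mul_ordCompl_eq_self i 2
  simp only [rewriteCopies, Multiset.sum_add, Multiset.sum_replicate, smul_eq_mul]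
  have e : (c - 3 * (c % 2)) / 2 * 2 + 3 * (c % 2) = c := by omega
  calc _ = (c - 3 * (c % 2)) / 2 * 2 * i + 3 * (c % 2) * (ordProj[2] i * ordCompl[2] i) := by ring
    _ = ((c - 3 * (c % 2)) / 2 * 2 + 3 * (c % 2)) * i := by rw [h]; ring
    _ = c * i := by rw [e]

theorem ordCompl_two_odd {i : ℕ} (hi : i ≠ 0) : ordCompl[2] i % 2 = 1 := by
  have := Nat.not_dvd_ordCompl Nat.prime_two hi
  omega

theorem rewriteCopies_mem {c i j : ℕ} (hi : 0 < i) (hj : j ∈ rewriteCopies c i) :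
    0 < j ∧ ¬ (j : ℤ) ≡ 1 [ZMOD 6] ∧ ¬ (j : ℤ) ≡ -1 [ZMOD 6] := by
  have h2 := ordCompl_two_odd hi.ne'
  simp only [rewriteCopies, Multiset.mem_add, Multiset.mem_replicate] at hj
  unfold Int.ModEq
  rcases hj with ⟨_, rfl⟩ | ⟨_, rfl⟩ <;> omega

namespace DesignatedPartition

/-- The parts of `α`. -/
def toAlpha {n : ℕ} (p : DesignatedPartition n) : Multiset ℕ :=
  ∑ i ∈ p.1.parts.toFinset, Multiset.replicate (p.outer i) i

/-- The parts of `β`. -/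
def toBeta {n : ℕ} (p : DesignatedPartition n) : Multiset ℕ :=
  ∑ i ∈ p.1.parts.toFinset, rewriteCopies (p.inner i) i

theorem sum_toAlpha_add {n : ℕ} (p : DesignatedPartition n) :
    p.toAlpha.sum + p.toBeta.sum = n := by
  have h1 : p.toAlpha.sum = ∑ i ∈ p.1.parts.toFinset, p.outer i * i := by
    simp [toAlpha, Multiset.sum_sum]
  have h2 : p.toBeta.sum = ∑ i ∈ p.1.parts.toFinset, p.inner i * i := by
    rw [toBeta, Multiset.sum_sum]
    exact Finset.sum_congr rfl fun i _ => rewriteCopies_sum _ _ (p.inner_ne_one i)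
  rw [h1, h2, ← Finset.sum_add_distrib]
  refine Eq.trans ?_ ((Finset.sum_multiset_count p.1.parts).symm.trans p.1.parts_sum)
  refine Finset.sum_congr rfl fun i _ => ?_
  rw [← add_mul, outer_add_inner, smul_eq_mul]

/-- The map `Δ`. -/
def toVector {n : ℕ} (p : DesignatedPartition n) : VectorPartition n :=
  VectorPartition.mk' p.toAlpha p.toBeta
    (fun i hi => by
      simp only [toAlpha, Multiset.mem_sum, Multiset.mem_replicate, Multiset.mem_toFinset] at hi
      obtain ⟨j, hj, _, rfl⟩ := hi
      exact p.1.parts_pos hj)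
    (fun i hi => by
      simp only [toBeta, Multiset.mem_sum, Multiset.mem_toFinset] at hi
      obtain ⟨j, hj, hi⟩ := hi
      exact (rewriteCopies_mem (p.1.parts_pos hj) hi).1)
    (fun i hi => by
      simp only [toBeta, Multiset.mem_sum, Multiset.mem_toFinset] at hi
      obtain ⟨j, hj, hi⟩ := hi
      exact (rewriteCopies_mem (p.1.parts_pos hj) hi).2)
    p.sum_toAlpha_add

theorem inner_eq_zero {n : ℕ} (p : DesignatedPartition n) {i : ℕ} (h : i ∉ p.1.parts) :
    p.inner i = 0 := by
  simp [inner, tagPos, h]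

theorem outer_eq_zero {n : ℕ} (p : DesignatedPartition n) {i : ℕ} (h : i ∉ p.1.parts) :
    p.outer i = 0 := by
  simp [outer, tagPos, h]

theorem count_toAlpha {n : ℕ} (p : DesignatedPartition n) (i : ℕ) :
    p.toAlpha.count i = p.outer i := by
  rw [toAlpha, Multiset.count_sum']
  simp only [Multiset.count_replicate]
  rw [Finset.sum_ite_eq']
  split_ifs with h
  · rfl
  · exact (p.outer_eq_zero (by simpa using h)).symm

theorem count_two_mul_toBeta {n : ℕ} (p : DesignatedPartition n) (i : ℕ) :
    p.toBeta.count (2 * i) = (p.inner i - 3 * (p.inner i % 2)) / 2 := by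
  have key : ∀ j ∈ p.1.parts.toFinset, (rewriteCopies (p.inner j) j).count (2 * i) =
      if j = i then (p.inner i - 3 * (p.inner i % 2)) / 2 else 0 := by
    intro j hj
    have hj0 := p.1.parts_pos (Multiset.mem_toFinset.1 hj)
    have h2 := ordCompl_two_odd hj0.ne'
    rw [rewriteCopies, Multiset.count_add, Multiset.count_replicate, Multiset.count_replicate,
      if_neg (by omega : ¬ 3 * ordCompl[2] j = 2 * i), add_zero]
    by_cases hji : j = i
    · subst hji; simp
    · rw [if_neg (by omega), if_neg hji]
  rw [toBeta, Multiset.count_sum', Finset.sum_congr rfl key, Finset.sum_ite_eq']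
  split_ifs with h
  · rfl
  · simp [p.inner_eq_zero (by simpa using h)]

theorem count_three_mul_toBeta {n : ℕ} (p : DesignatedPartition n) (d : ℕ) (hd : d % 2 = 1) :
    p.toBeta.count (3 * d) =
      ∑ k ∈ (Finset.range (n + 1)).filter (fun k => p.inner (2 ^ k * d) % 2 = 1), 2 ^ k := by
  have key : ∀ j ∈ p.1.parts.toFinset, (rewriteCopies (p.inner j) j).count (3 * d) =
      if ordCompl[2] j = d ∧ p.inner j % 2 = 1 then ordProj[2] j else 0 := by
    intro j hj
    rw [rewriteCopies, Multiset.count_add, Multiset.count_replicate, Multiset.count_replicate,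
      if_neg (by omega : ¬ 2 * j = 3 * d), zero_add]
    rcases Nat.mod_two_eq_zero_or_one (p.inner j) with h | h <;> simp [h]
  rw [toBeta, Multiset.count_sum', Finset.sum_congr rfl key, ← Finset.sum_filter]
  symm
  have hdn : ¬ 2 ∣ d := by omega
  have hfac : ∀ k, (2 ^ k * d).factorization 2 = k := by
    intro k
    rw [Nat.factorization_mul (by positivity) (by omega), Finsupp.add_apply,
      Nat.factorization_eq_zero_of_not_dvd hdn]
    simp [Nat.prime_two.factorization_pow]
  refine Finset.sum_bij (fun k _ => 2 ^ k * d) ?_ ?_ ?_ ?_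
  · intro k hk
    simp only [Finset.mem_filter, Finset.mem_range] at hk
    have hmem : 2 ^ k * d ∈ p.1.parts := by
      by_contra h
      rw [p.inner_eq_zero h] at hk
      omega
    simp only [Finset.mem_filter, Multiset.mem_toFinset]
    refine ⟨hmem, ?_, hk.2⟩
    rw [hfac, Nat.mul_div_cancel_left _ (by positivity)]
  · intro k _ l _ h
    have := congrArg (fun x => x.factorization 2) h
    simpa only [hfac] using this
  · intro j hj
    simp only [Finset.mem_filter, Multiset.mem_toFinset] at hj
    obtain ⟨hj, hjd, hjo⟩ := hj
    have e : 2 ^ j.factorization 2 * d = j := by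
      rw [← hjd]; exact Nat.ordProj_mul_ordCompl_eq_self j 2
    refine ⟨j.factorization 2, ?_, e⟩
    simp only [Finset.mem_filter, Finset.mem_range]
    refine ⟨?_, by rwa [e]⟩
    have h1 : j ≤ n := p.1.parts_sum ▸ Multiset.le_sum_of_mem hj
    have h2 : j.factorization 2 < j := Nat.factorization_lt 2 (p.1.parts_pos hj).ne'
    omega
  · intro k _
    simp only [hfac]

theorem toVector_injective (n : ℕ) :
    Function.Injective (toVector : DesignatedPartition n → VectorPartition n) := by
  intro p q h
  have ha : p.toAlpha = q.toAlpha := congrArg VectorPartition.alphaParts h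
  have hb : p.toBeta = q.toBeta := congrArg VectorPartition.betaParts h
  have hout : ∀ i, p.outer i = q.outer i := fun i => by
    rw [← count_toAlpha, ← count_toAlpha, ha]
  have hpar : ∀ i, p.inner i % 2 = q.inner i % 2 := by
    intro i
    rcases Nat.eq_zero_or_pos i with rfl | hi
    · rw [p.inner_eq_zero fun h => absurd (p.1.parts_pos h) (lt_irrefl 0),
        q.inner_eq_zero fun h => absurd (q.1.parts_pos h) (lt_irrefl 0)]
    by_cases hin : i ≤ n
    · have h2 := ordCompl_two_odd hi.ne'
      have e := p.count_three_mul_toBeta _ h2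
      rw [hb, q.count_three_mul_toBeta _ h2] at e
      have e' := Finset.ext_iff.1 (Finset.geomSum_injective (le_refl 2) e) (i.factorization 2)
      have h3 : i.factorization 2 < n + 1 := by
        have := Nat.factorization_lt 2 hi.ne'
        omega
      simp only [Finset.mem_filter, Finset.mem_range, h3, true_and,
        Nat.ordProj_mul_ordCompl_eq_self] at e'
      omega
    · have hp : i ∉ p.1.parts := fun h => hin (p.1.parts_sum ▸ Multiset.le_sum_of_mem h)
      have hq : i ∉ q.1.parts := fun h => hin (q.1.parts_sum ▸ Multiset.le_sum_of_mem h)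
      rw [p.inner_eq_zero hp, q.inner_eq_zero hq]
  have hinn : ∀ i, p.inner i = q.inner i := by
    intro i
    have e := p.count_two_mul_toBeta i
    rw [hb, q.count_two_mul_toBeta] at e
    have := hpar i
    have := p.inner_ne_one i
    have := q.inner_ne_one i
    omega
  have hcount : ∀ i, p.1.parts.count i = q.1.parts.count i := fun i => by
    rw [← outer_add_inner, ← outer_add_inner, hout, hinn]
  refine ext_tagPos hcount fun i => ?_
  by_cases hi : i ∈ p.1.parts
  · have hi' : i ∈ q.1.parts := by
      rw [← Multiset.count_pos, ← hcount, Multiset.count_pos]; exact hi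
    have e := hinn i
    have := p.tagPos_pos hi
    have := q.tagPos_pos hi'
    unfold inner at e
    split_ifs at e <;> omega
  · have hi' : i ∉ q.1.parts := by
      rw [← Multiset.count_pos, ← hcount, Multiset.count_pos]; exact hi
    simp [tagPos, hi, hi']

/-- There is a partition with designated summands with prescribed numbers `a i` and `c i ≠ 1` of
outer and inner copies of `i`. -/
theorem exists_outer_inner (N : ℕ) (a c : ℕ → ℕ) (hc : ∀ i, c i ≠ 1)
    (h0 : a 0 = 0 ∧ c 0 = 0) (hN : ∀ i, N < i → a i = 0 ∧ c i = 0) :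
    ∃ (n : ℕ) (p : DesignatedPartition n), ∀ i, p.outer i = a i ∧ p.inner i = c i := by
  let s : Multiset ℕ := ∑ i ∈ Finset.range (N + 1), Multiset.replicate (a i + c i) i
  have hs : ∀ i, s.count i = a i + c i := by
    intro i
    simp only [s, Multiset.count_sum', Multiset.count_replicate]
    rw [Finset.sum_ite_eq']
    split_ifs with h
    · rfl
    · have := hN i (by simpa [Nat.lt_succ_iff] using h)
      omega
  have hpos : ∀ {i}, i ∈ s → 0 < i := by
    intro i hi
    rw [← Multiset.count_pos, hs] at hi
    rcases Nat.eq_zero_or_pos i with rfl | h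
    · omega
    · exact h
  have hlt : ∀ i ∈ s.toFinset, c i - 1 < s.count i := by
    intro i hi
    rw [Multiset.mem_toFinset, ← Multiset.count_pos] at hi
    have := hs i
    omega
  refine ⟨s.sum, ⟨⟨s, hpos, rfl⟩, fun i => ⟨c i - 1, hlt i i.2⟩⟩, fun i => ?_⟩
  have := hs i
  have hci := hc i
  by_cases hi : i ∈ s
  · simp only [outer, inner, tagPos, Multiset.mem_toFinset, hi, dif_pos]
    split_ifs <;> omega
  · have h00 : s.count i = 0 := Multiset.count_eq_zero.2 hi
    simp only [outer, inner, tagPos, Multiset.mem_toFinset, hi, dif_neg, not_false_eq_true,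
      Nat.zero_le, if_true]
    omega

theorem toVector_surjective (n : ℕ) :
    Function.Surjective (toVector : DesignatedPartition n → VectorPartition n) := by
  intro v
  have hα0 : v.alphaParts.count 0 = 0 :=
    Multiset.count_eq_zero.2 fun h => absurd (v.2.1.parts_pos h) (lt_irrefl 0)
  have hβ0 : v.betaParts.count 0 = 0 :=
    Multiset.count_eq_zero.2 fun h => absurd (v.2.2.1.parts_pos h) (lt_irrefl 0)
  have hsum : v.alphaParts.sum + v.betaParts.sum = n := by
    have := Finset.HasAntidiagonal.mem_antidiagonal.1 v.1.2
    have h1 : v.alphaParts.sum = _ := v.2.1.parts_sum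
    have h2 : v.betaParts.sum = _ := v.2.2.1.parts_sum
    omega
  have hαn : ∀ i, n < i → v.alphaParts.count i = 0 := fun i hi =>
    Multiset.count_eq_zero.2 fun h => by have := Multiset.le_sum_of_mem h; omega
  have hβn : ∀ i, n < i → v.betaParts.count i = 0 := fun i hi =>
    Multiset.count_eq_zero.2 fun h => by have := Multiset.le_sum_of_mem h; omega
  let bits : ℕ → Finset ℕ := fun d => (Nat.bitIndices (v.betaParts.count (3 * d))).toFinset
  have hbits : ∀ d, ∑ k ∈ bits d, 2 ^ k = v.betaParts.count (3 * d) := fun d =>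
    Finset.sum_toFinset_bitIndices_two_pow _
  have hbn : ∀ d k, k ∈ bits d → 2 ^ k * d ≤ n := by
    intro d k hk
    have h1 : 2 ^ k ≤ v.betaParts.count (3 * d) := by
      rw [← hbits]
      exact Finset.single_le_sum (f := fun k => 2 ^ k) (fun _ _ => Nat.zero_le _) hk
    have h2 : v.betaParts.count (3 * d) * (3 * d) ≤ v.betaParts.sum := by
      have hle : Multiset.replicate (v.betaParts.count (3 * d)) (3 * d) ≤ v.betaParts :=
        Multiset.le_count_iff_replicate_le.1 le_rfl
      obtain ⟨u, hu⟩ := Multiset.le_iff_exists_add.1 hle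
      have := congrArg Multiset.sum hu
      rw [Multiset.sum_add, Multiset.sum_replicate, smul_eq_mul] at this
      omega
    have h3 : 2 ^ k * d ≤ v.betaParts.count (3 * d) * (3 * d) :=
      Nat.mul_le_mul h1 (by omega)
    omega
  let c : ℕ → ℕ := fun i => if i = 0 then 0 else
    2 * v.betaParts.count (2 * i) + 3 * (if i.factorization 2 ∈ bits (ordCompl[2] i) then 1 else 0)
  have hc1 : ∀ i, c i ≠ 1 := by
    intro i
    simp only [c]
    split_ifs <;> omega
  obtain ⟨n', p, hp⟩ := exists_outer_inner n (fun i => v.alphaParts.count i) c hc1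
    ⟨hα0, by simp [c]⟩ (fun i hi => ⟨hαn i hi, by
      have h1 := hβn (2 * i) (by omega)
      have h2 : i.factorization 2 ∉ bits (ordCompl[2] i) := fun h => by
        have := hbn _ _ h
        rw [Nat.ordProj_mul_ordCompl_eq_self] at this
        omega
      simp [c, h1, h2]⟩)
  have hA : p.toAlpha = v.alphaParts := by
    ext i
    rw [count_toAlpha, (hp i).1]
  have hB : p.toBeta = v.betaParts := by
    ext j
    rcases Nat.mod_two_eq_zero_or_one j with hj | hj
    · obtain ⟨i, rfl⟩ : ∃ i, j = 2 * i := ⟨j / 2, by omega⟩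
      rw [count_two_mul_toBeta, (hp i).2]
      simp only [c]
      rcases Nat.eq_zero_or_pos i with rfl | hi
      · simp [hβ0]
      · rw [if_neg hi.ne']
        split_ifs <;> omega
    by_cases h3 : j % 3 = 0
    · obtain ⟨d, rfl⟩ : ∃ d, j = 3 * d := ⟨j / 3, by omega⟩
      have hd : d % 2 = 1 := by omega
      rw [count_three_mul_toBeta p d hd, ← hbits]
      have hdn : ¬ 2 ∣ d := by omega
      have hfac : ∀ k, (2 ^ k * d).factorization 2 = k := by
        intro k
        rw [Nat.factorization_mul (by positivity) (by omega), Finsupp.add_apply,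
          Nat.factorization_eq_zero_of_not_dvd hdn]
        simp [Nat.prime_two.factorization_pow]
      have hiff : ∀ k, p.inner (2 ^ k * d) % 2 = 1 ↔ k ∈ bits d := by
        intro k
        have hne : 2 ^ k * d ≠ 0 := Nat.mul_ne_zero (by positivity) (by omega)
        rw [(hp _).2]
        simp only [c]
        rw [if_neg hne, hfac, Nat.mul_div_cancel_left _ (by positivity)]
        split_ifs with h
        · exact iff_of_true (by omega) h
        · exact iff_of_false (by omega) h
      congr 1
      ext k
      simp only [Finset.mem_filter, Finset.mem_range, hiff]
      refine ⟨fun h => h.2, fun h => ⟨?_, h⟩⟩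
      have hmem : 2 ^ k * d ∈ p.1.parts := by
        by_contra h0
        have h1 := (hiff k).2 h
        rw [p.inner_eq_zero h0] at h1
        omega
      have h5 : 2 ^ k * d ≤ n' := p.1.parts_sum ▸ Multiset.le_sum_of_mem hmem
      have h6 : 2 ^ k * 1 ≤ 2 ^ k * d := Nat.mul_le_mul_left _ (by omega)
      have hlt : k < 2 ^ k := Nat.lt_two_pow_self
      omega
    · have hv : j ∉ v.betaParts := fun h => by
        have := v.2.2.2 j h
        unfold Int.ModEq at this
        omega
      have hq : j ∉ p.toBeta := fun h => by
        have := p.toVector.2.2.2 j h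
        unfold Int.ModEq at this
        omega
      rw [Multiset.count_eq_zero.2 hv, Multiset.count_eq_zero.2 hq]
  have hn : n' = n := by rw [← p.sum_toAlpha_add, hA, hB, hsum]
  subst hn
  exact ⟨p, VectorPartition.ext_parts hA hB⟩

end DesignatedPartition

/-- An explicit bijection `Δ` between partitions of `n` with designated summands and vector
partitions `(α, β)` with `|α| + |β| = n`. -/
noncomputable def designatedBijection (n : ℕ) : DesignatedPartition n ≃ VectorPartition n :=
  Equiv.ofBijective DesignatedPartition.toVector
    ⟨DesignatedPartition.toVector_injective n, DesignatedPartition.toVector_surjective n⟩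

/-! Transporting along Δ × Δ, the generating function of the `pd`-crank is B² / ((zq; q)_∞ (q/z;
q)_∞), where B counts partitions into parts not ≡ ±1 mod 6, so the choice of Δ is irrelevant.
Symmetry comes from exchanging the two components. It remains to show that C_m - C_{m+1}, times B²,
has nonnegative coefficients for m ≥ 0 (outside degrees 1, 5, 7 when m = 0), where C_m = ∑_k
q^(2k+m) / ((q)_k (q)_{m+k}) is the coefficient of z^m in 1 / ((zq; q)_∞ (q/z; q)_∞).

The q-Chu–Vandermonde identity (Durfee rectangles) and Euler's identity factor C_m as 1/(q²; q)_∞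
times a sum over j. In the difference of two such sums a telescoping series is removed, leaving
summands with an explicit factor 1 - q. The negative terms are then cancelled against the
denominators: `coeffNonneg_summand_of_pos` does this for each summand when m ≥ 1.

For m = 0 a second telescoping is needed, and the result is C_0 - C_1 = 1 - q + q⁴ + (a nonnegative
series), in `exists_coeffNonneg_crankSum_zero`. The remaining -q is compensated only after
multiplication by B²: (1 - q + q⁴) B² + q + q⁵ + q⁷ is nonnegative
(`coeffNonneg_mul_betaSeries_sq`), which is where the exceptions 1, 5, 7 come from.

All infinite sums and products are replaced by finite ones modulo `X ^ N`; the coefficient of degree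
n needs only N = n + 1. -/

open PowerSeries in
/-- All coefficients of an integer power series are nonnegative. -/
def CoeffNonneg (f : PowerSeries ℤ) : Prop := ∀ n, 0 ≤ coeff n f

/-! ### Closure properties of series with nonnegative coefficients. -/

namespace CoeffNonneg
open PowerSeries

variable {f g : PowerSeries ℤ}

theorem zero : CoeffNonneg 0 := fun n => by simp

theorem add (hf : CoeffNonneg f) (hg : CoeffNonneg g) : CoeffNonneg (f + g) := fun n => by
  rw [map_add]; exact add_nonneg (hf n) (hg n)

theorem mul (hf : CoeffNonneg f) (hg : CoeffNonneg g) : CoeffNonneg (f * g) := fun n => by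
  rw [coeff_mul]; exact Finset.sum_nonneg fun p _ => mul_nonneg (hf _) (hg _)

theorem X_pow (k : ℕ) : CoeffNonneg (X ^ k) := fun n => by
  rw [coeff_X_pow]; split_ifs <;> norm_num

theorem one : CoeffNonneg 1 := by simpa using X_pow 0

theorem X : CoeffNonneg X := by simpa using X_pow 1

theorem sum {ι : Type*} {s : Finset ι} {f : ι → PowerSeries ℤ} (h : ∀ i ∈ s, CoeffNonneg (f i)) :
    CoeffNonneg (∑ i ∈ s, f i) := fun n => by
  rw [map_sum]; exact Finset.sum_nonneg fun i hi => h i hi n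

theorem prod {ι : Type*} {s : Finset ι} {f : ι → PowerSeries ℤ} (h : ∀ i ∈ s, CoeffNonneg (f i)) :
    CoeffNonneg (∏ i ∈ s, f i) := by
  classical
  induction s using Finset.induction_on with
  | empty => simpa using one
  | insert a s ha ih =>
    rw [Finset.prod_insert ha]
    exact (h a (by simp)).mul (ih fun i hi => h i (by simp [hi]))

theorem pow (hf : CoeffNonneg f) (k : ℕ) : CoeffNonneg (f ^ k) := by
  induction k with
  | zero => simpa using one
  | succ k ih => rw [pow_succ]; exact ih.mul hf

end CoeffNonneg

/-! ### Reciprocals of finite q-products and the q-Chu–Vandermonde identity. -/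

section QSeries
open PowerSeries

/-- The geometric series `1 / (1 - X ^ a)`. -/
noncomputable def geomSeries (a : ℕ) : PowerSeries ℤ := mk fun n => if a ∣ n then 1 else 0

theorem coeffNonneg_geomSeries (a : ℕ) : CoeffNonneg (geomSeries a) := fun n => by
  rw [geomSeries, coeff_mk]; split_ifs <;> norm_num

theorem geomSeries_mul_one_sub {a : ℕ} (ha : 1 ≤ a) : geomSeries a * (1 - X ^ a) = 1 := by
  ext n
  rw [mul_sub, mul_one, map_sub, coeff_mul_X_pow', geomSeries, coeff_mk, coeff_one]
  by_cases h : a ≤ n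
  · rw [if_pos h, coeff_mk, if_neg (by omega : n ≠ 0)]
    have : a ∣ n - a ↔ a ∣ n := Nat.dvd_sub_iff_left h dvd_rfl
    simp [this]
  · rw [if_neg h]
    by_cases h0 : n = 0
    · simp [h0]
    · rw [if_neg (fun hd => h (Nat.le_of_dvd (by omega) hd)), if_neg h0, sub_zero]

/-- `1 / ((1 - X ^ a) ⋯ (1 - X ^ b))`. -/
noncomputable def geomProd (a b : ℕ) : PowerSeries ℤ := ∏ i ∈ Finset.Icc a b, geomSeries i

theorem coeffNonneg_geomProd (a b : ℕ) : CoeffNonneg (geomProd a b) :=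
  CoeffNonneg.prod fun i _ => coeffNonneg_geomSeries i

theorem geomProd_of_lt {a b : ℕ} (h : b < a) : geomProd a b = 1 := by
  simp [geomProd, h]

theorem geomProd_succ_right {a b : ℕ} (h : a ≤ b + 1) :
    geomProd a (b + 1) = geomProd a b * geomSeries (b + 1) :=
  Finset.prod_Icc_succ_top h _

theorem geomProd_eq_mul {a b : ℕ} (h : a ≤ b) :
    geomProd a b = geomSeries a * geomProd (a + 1) b := by
  rw [geomProd, ← Finset.insert_Icc_succ_left_eq_Icc h, Finset.prod_insert (by simp)]
  rfl

theorem geomProd_mul_one_sub {a b : ℕ} (ha : 1 ≤ a) (h : a ≤ b) :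
    geomProd a b * (1 - X ^ a) = geomProd (a + 1) b := by
  rw [geomProd_eq_mul h]
  linear_combination geomProd (a + 1) b * geomSeries_mul_one_sub ha

theorem geomProd_succ_mul_one_sub {a b : ℕ} (h : a ≤ b + 1) :
    geomProd a (b + 1) * (1 - X ^ (b + 1)) = geomProd a b := by
  rw [geomProd_succ_right h]
  linear_combination geomProd a b * geomSeries_mul_one_sub (Nat.le_add_left 1 b)

/-- The factor `1 - X ^ c` cancels one geometric series of the product. Every positivity proof below
reduces to writing a polynomial as a sum of terms whose negative parts cancel in this way. -/
theorem coeffNonneg_geomProd_mul_one_sub {a b c : ℕ} (ha : 1 ≤ a) (hac : a ≤ c) (hcb : c ≤ b) :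
    CoeffNonneg (geomProd a b * (1 - X ^ c)) := by
  have hc : c ∈ Finset.Icc a b := by simp [hac, hcb]
  have e : geomProd a b * (1 - X ^ c) = ∏ i ∈ (Finset.Icc a b).erase c, geomSeries i := by
    rw [geomProd, ← Finset.mul_prod_erase _ _ hc]
    linear_combination (∏ i ∈ (Finset.Icc a b).erase c, geomSeries i) *
      geomSeries_mul_one_sub (ha.trans hac)
  rw [e]
  exact CoeffNonneg.prod fun i _ => coeffNonneg_geomSeries i

theorem geomProd_one_succ (k : ℕ) :
    geomProd 1 (k + 1) * (1 - X ^ (k + 1)) = geomProd 1 k :=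
  geomProd_succ_mul_one_sub (by omega)

/-- A form of the `q`-Chu–Vandermonde identity. -/
theorem sum_antidiagonal_geomProd (k m : ℕ) :
    ∑ p ∈ Finset.HasAntidiagonal.antidiagonal k,
      X ^ (p.2 * (p.2 + m)) * geomProd 1 p.2 * geomProd 1 p.1 * geomProd 1 (m + p.2) =
    geomProd 1 k * geomProd 1 (m + k) := by
  induction k generalizing m with
  | zero => simp [geomProd_of_lt]
  | succ k ih =>
    have h1 : (1 - X ^ (k + 1) : PowerSeries ℤ) ≠ 0 := fun h => by
      have := geomSeries_mul_one_sub (Nat.le_add_left 1 k)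
      rw [h, mul_zero] at this
      exact zero_ne_one this
    apply mul_right_cancel₀ h1
    have e1 : geomProd 1 (k + 1) * geomProd 1 (m + (k + 1)) * (1 - X ^ (k + 1)) =
        geomProd 1 k * geomProd 1 (m + 1 + k) := by
      rw [show m + (k + 1) = m + 1 + k by ring]
      linear_combination geomProd 1 (m + 1 + k) * geomProd_one_succ k
    rw [e1, ← ih, Finset.sum_mul]
    -- With p = (i, j) and i + j = k + 1, write 1 - q^(k+1) = (1 - q^j) + q^j (1 - q^i). Each piece
    -- cancels the top factor of 1/(q)_j or 1/(q)_i. The boundary terms vanish, and after a shift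
    -- the two sums merge into the case k with m + 1.
    have e2 : ∀ p ∈ Finset.HasAntidiagonal.antidiagonal (k + 1),
        X ^ (p.2 * (p.2 + m)) * geomProd 1 p.2 * geomProd 1 p.1 * geomProd 1 (m + p.2) *
          (1 - X ^ (k + 1)) =
        X ^ (p.2 * (p.2 + m)) * geomProd 1 p.1 * geomProd 1 (m + p.2) *
          (geomProd 1 p.2 * (1 - X ^ p.2)) +
        X ^ (p.2 * (p.2 + m) + p.2) * geomProd 1 p.2 * geomProd 1 (m + p.2) *
          (geomProd 1 p.1 * (1 - X ^ p.1)) := by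
      intro p hp
      rw [← Finset.HasAntidiagonal.mem_antidiagonal.1 hp]
      ring
    rw [Finset.sum_congr rfl e2, Finset.sum_add_distrib, Finset.Nat.sum_antidiagonal_succ',
      Finset.Nat.sum_antidiagonal_succ]
    simp only [geomProd_one_succ, pow_zero, sub_self, mul_zero, zero_add, add_zero]
    rw [← Finset.sum_add_distrib]
    refine Finset.sum_congr rfl fun p _ => ?_
    have e3 := geomProd_one_succ (m + p.2)
    rw [show m + (p.2 + 1) = m + p.2 + 1 by ring, show m + 1 + p.2 = m + p.2 + 1 by ring, ← e3]
    ring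

end QSeries

/-! ### Euler and Durfee expansions of the crank series, modulo a power of X. -/

section TruncatedSums
open PowerSeries

/-- The truncation at `k < N` of the sum of `X ^ (a k) / (q)_k`. -/
noncomputable def eulerSum (a N : ℕ) : PowerSeries ℤ :=
  ∑ k ∈ Finset.range N, X ^ (a * k) * geomProd 1 k

/-- Truncated form of E_a (1 - q^a) = E_{a+1} for E_a = 1/(q^a; q)_∞. Since 1 - q^k cancels the top
factor of 1/(q)_k, E_a - E_{a+1} is a shift of q^a E_a; the truncation error is the last term of the
sum. -/
theorem eulerSum_step {a N : ℕ} (ha : 1 ≤ a) :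
    X ^ N ∣ eulerSum a N * (1 - X ^ a) - eulerSum (a + 1) N := by
  cases N with
  | zero => simp
  | succ N =>
    have e : eulerSum a (N + 1) * (1 - X ^ a) - eulerSum (a + 1) (N + 1) =
        - (X ^ (a * (N + 1)) * geomProd 1 N) := by
      have h1 : eulerSum a (N + 1) - eulerSum (a + 1) (N + 1) =
          ∑ k ∈ Finset.range N, X ^ (a * (k + 1)) * geomProd 1 k := by
        rw [eulerSum, eulerSum, ← Finset.sum_sub_distrib, Finset.sum_range_succ']
        simp only [mul_zero, pow_zero, sub_self, add_zero]
        refine Finset.sum_congr rfl fun k _ => ?_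
        rw [← geomProd_one_succ k]
        ring
      have h2 : eulerSum a (N + 1) * X ^ a =
          ∑ k ∈ Finset.range N, X ^ (a * (k + 1)) * geomProd 1 k +
            X ^ (a * (N + 1)) * geomProd 1 N := by
        rw [← Finset.sum_range_succ (fun k => X ^ (a * (k + 1)) * geomProd 1 k), eulerSum,
          Finset.sum_mul]
        exact Finset.sum_congr rfl fun k _ => by ring
      linear_combination h1 - h2
    rw [e, dvd_neg]
    exact Dvd.dvd.mul_right (pow_dvd_pow _ (by nlinarith)) _

/-- Euler's identity ∑ q^(ak)/(q)_k = 1/(q^a; q)_∞, by downward induction on a. At a = M + 1 the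
product is empty and all terms with k ≥ 1 are divisible by `X ^ N`. -/
theorem dvd_eulerSum_sub_geomProd {a N M : ℕ} (ha : 1 ≤ a) (haM : a ≤ M + 1) (hN : N ≤ M + 1) :
    X ^ N ∣ eulerSum a N - geomProd a M := by
  induction haM using Nat.decreasingInduction with
  | self =>
    cases N with
    | zero => simp
    | succ N =>
      rw [geomProd_of_lt (Nat.lt_succ_self M), eulerSum, Finset.sum_range_succ']
      simp only [mul_zero, pow_zero, geomProd_of_lt zero_lt_one, mul_one, add_sub_cancel_right]
      refine Finset.dvd_sum fun k _ => Dvd.dvd.mul_right (pow_dvd_pow _ ?_) _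
      nlinarith
  | of_succ a h ih =>
    have h1 := dvd_add (eulerSum_step (N := N) ha) (ih (by omega))
    rw [← geomProd_mul_one_sub ha (by omega : a ≤ M)] at h1
    have h2 := Dvd.dvd.mul_left h1 (geomSeries a)
    convert h2 using 1
    linear_combination (geomProd a M - eulerSum a N) * geomSeries_mul_one_sub ha

/-- The truncation at `k < N` of the coefficient of `z ^ m` in `1 / ((zq; q)_∞ (q/z; q)_∞)`. -/
noncomputable def crankSum (m N : ℕ) : PowerSeries ℤ :=
  ∑ k ∈ Finset.range N, X ^ (2 * k + m) * geomProd 1 k * geomProd 1 (m + k)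

/-- The sum over Durfee rectangles in the crank generating function, truncated at `j < N`. -/
noncomputable def durfeeSum (m N : ℕ) : PowerSeries ℤ :=
  ∑ j ∈ Finset.range N, X ^ (j * (j + m) + 2 * j + m) * geomProd 1 j * geomProd 1 (m + j)

/-- Expanding 1/((q)_k (q)_{m+k}) by q-Chu–Vandermonde with k = i + j, the weight q^(2k) splits as
q^(2i) q^(2j). The two sides are the same double sum over i + j < N and over i, j < N; the extra
terms are divisible by q^(i+j). -/
theorem dvd_crankSum_sub (m N : ℕ) : X ^ N ∣ crankSum m N - eulerSum 2 N * durfeeSum m N := by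
  let F : ℕ × ℕ → PowerSeries ℤ := fun p => (X ^ (2 * p.1) * geomProd 1 p.1) *
    (X ^ (p.2 * (p.2 + m) + 2 * p.2 + m) * geomProd 1 p.2 * geomProd 1 (m + p.2))
  let S := Finset.range N ×ˢ Finset.range N
  have h1 : eulerSum 2 N * durfeeSum m N = ∑ p ∈ S, F p := by
    rw [eulerSum, durfeeSum, Finset.sum_mul_sum, Finset.sum_product]
  have h2 : crankSum m N = ∑ p ∈ S with p.1 + p.2 < N, F p := by
    rw [← Finset.sum_fiberwise_of_maps_to (g := fun p => p.1 + p.2) (t := Finset.range N)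
      (by simp)]
    refine Finset.sum_congr rfl fun k hk => ?_
    rw [mul_assoc, ← sum_antidiagonal_geomProd, Finset.mul_sum]
    have hk' := Finset.mem_range.1 hk
    refine Finset.sum_congr ?_ fun p hp => ?_
    · ext p
      simp only [S, Finset.HasAntidiagonal.mem_antidiagonal, Finset.mem_filter, Finset.mem_product,
        Finset.mem_range]
      omega
    · simp only [S, Finset.mem_filter] at hp
      rw [← hp.2]
      simp only [F]
      ring
  rw [h1, h2, ← Finset.sum_filter_add_sum_filter_not S (fun p => p.1 + p.2 < N), sub_add_cancel_left,
    dvd_neg]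
  refine Finset.dvd_sum fun p hp => ?_
  simp only [Finset.mem_filter, not_lt] at hp
  have e : F p = X ^ (p.1 + p.2) * (X ^ (p.1 + p.2 * (p.2 + m) + p.2 + m) * geomProd 1 p.1 *
      geomProd 1 p.2 * geomProd 1 (m + p.2)) := by
    simp only [F]; ring
  rw [e]
  exact Dvd.dvd.mul_right (pow_dvd_pow _ hp.2) _

/-- The basic term of the sums over Durfee rectangles. -/
noncomputable def durfeeTerm (m j : ℕ) : PowerSeries ℤ :=
  X ^ (j * (j + m) + 2 * j + m) * geomProd 1 j * geomProd 1 (m + j + 1)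

theorem pow_dvd_durfeeTerm (m j : ℕ) : X ^ j ∣ durfeeTerm m j := by
  rw [durfeeTerm, mul_assoc]
  exact Dvd.dvd.mul_right (pow_dvd_pow _ (by nlinarith)) _

/-- The ratio of consecutive terms, which lets the telescoping differences below be expressed
through `durfeeTerm m j` alone. -/
theorem durfeeTerm_succ (m j : ℕ) :
    durfeeTerm m (j + 1) * (1 - X ^ (j + 1)) * (1 - X ^ (m + j + 2)) =
      durfeeTerm m j * X ^ (2 * j + m + 3) := by
  have h1 := geomProd_one_succ j
  have h2 := geomProd_one_succ (m + j + 1)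
  rw [durfeeTerm, durfeeTerm, ← h1, ← h2, show m + (j + 1) + 1 = m + j + 1 + 1 by ring]
  ring

/-- Subtracting termwise leaves the factor 1 - q^(m+j+1) - q^(j+1), which is not divisible by 1 - q.
Adding a telescoping series makes 1 - q split off. -/
theorem dvd_durfeeSum_sub (m N : ℕ) :
    X ^ N ∣ durfeeSum m N - durfeeSum (m + 1) N - ∑ j ∈ Finset.range N,
      (1 - X) * (X ^ (2 * j) * durfeeTerm m j *
        (1 - X ^ (m + 2) - X ^ (j + m + 1) * (1 - X ^ 3))) := by
  -- The factor 1 - q^j makes T 0 vanish, and T N is divisible by `X ^ N`. The factors (1 - q^j)(1 -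
  -- q^(m+j+1)) are those that `durfeeTerm_succ` absorbs in T (j + 1).
  let T : ℕ → PowerSeries ℤ := fun j =>
    durfeeTerm m j * (1 - X ^ j) * (1 - X ^ (m + j + 1)) * (-1 + (X - 1) * X ^ j)
  have e : durfeeSum m N - durfeeSum (m + 1) N - ∑ j ∈ Finset.range N,
      (1 - X) * (X ^ (2 * j) * durfeeTerm m j *
        (1 - X ^ (m + 2) - X ^ (j + m + 1) * (1 - X ^ 3))) = T N - T 0 := by
    rw [← Finset.sum_range_sub, durfeeSum, durfeeSum, ← Finset.sum_sub_distrib,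
      ← Finset.sum_sub_distrib]
    refine Finset.sum_congr rfl fun j _ => ?_
    have h1 := durfeeTerm_succ m j
    have h2 : X ^ (j * (j + m) + 2 * j + m) * geomProd 1 j * geomProd 1 (m + j) =
        durfeeTerm m j * (1 - X ^ (m + j + 1)) := by
      rw [durfeeTerm, ← geomProd_one_succ (m + j)]
      ring
    have h3 : X ^ (j * (j + (m + 1)) + 2 * j + (m + 1)) * geomProd 1 j * geomProd 1 (m + 1 + j) =
        durfeeTerm m j * X ^ (j + 1) := by
      rw [durfeeTerm, show m + 1 + j = m + j + 1 by ring]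
      ring
    simp only [T]
    rw [h2, h3, show m + (j + 1) + 1 = m + j + 2 by ring, h1]
    ring
  have h0 : T 0 = 0 := by simp [T]
  rw [e, h0, sub_zero]
  simp only [T, mul_assoc]
  exact Dvd.dvd.mul_right (pow_dvd_durfeeTerm m N) _

theorem dvd_crankSum_sub_crankSum {m N M : ℕ} (hN : N ≤ M + 1) (hM : 1 ≤ M) :
    X ^ N ∣ crankSum m N - crankSum (m + 1) N - ∑ j ∈ Finset.range N,
      geomProd 2 M * (1 - X) * (X ^ (2 * j) * durfeeTerm m j *
        (1 - X ^ (m + 2) - X ^ (j + m + 1) * (1 - X ^ 3))) := by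
  have h1 := dvd_crankSum_sub m N
  have h2 := dvd_crankSum_sub (m + 1) N
  have h3 := Dvd.dvd.mul_left (dvd_durfeeSum_sub m N) (geomProd 2 M)
  have h4 := Dvd.dvd.mul_right (dvd_eulerSum_sub_geomProd (a := 2) (by norm_num)
    (by omega : 2 ≤ M + 1) hN) (durfeeSum m N - durfeeSum (m + 1) N)
  have h5 := dvd_add (dvd_add (dvd_sub h1 h2) h3) h4
  convert h5 using 1
  simp only [mul_assoc (geomProd 2 M), ← Finset.mul_sum]
  ring

/-- For `m = 0` the summands can be rewritten once more. -/
theorem dvd_sum_durfeeTerm_zero (N : ℕ) :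
    X ^ N ∣ ∑ j ∈ Finset.range N, X ^ (2 * j) * durfeeTerm 0 j *
        (1 - X ^ 2 - X ^ (j + 1) * (1 - X ^ 3)) -
      ∑ j ∈ Finset.range N, (1 - X) * (X ^ (3 * j) * durfeeTerm 0 j *
        (1 + X - X ^ 3 - X ^ (j + 1) * (1 + X) * (1 - X ^ 4))) := by
  -- The original factor is (1 - X)(1 + X - X^(j+1)(1 + X + X²)), whose cofactor takes the value -1
  -- at X = 1 and so rules out positivity. This telescoping replaces it by X^j times a cofactor with
  -- value 1 at X = 1.
  let T : ℕ → PowerSeries ℤ := fun j =>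
    X ^ (2 * j) * (durfeeTerm 0 j * ((1 - X ^ j) * (1 - X ^ (j + 1)) * (X ^ 2 - 1)))
  have e : ∑ j ∈ Finset.range N, X ^ (2 * j) * durfeeTerm 0 j *
        (1 - X ^ 2 - X ^ (j + 1) * (1 - X ^ 3)) -
      ∑ j ∈ Finset.range N, (1 - X) * (X ^ (3 * j) * durfeeTerm 0 j *
        (1 + X - X ^ 3 - X ^ (j + 1) * (1 + X) * (1 - X ^ 4))) = T N - T 0 := by
    rw [← Finset.sum_range_sub, ← Finset.sum_sub_distrib]
    refine Finset.sum_congr rfl fun j _ => ?_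
    have h1 := durfeeTerm_succ 0 j
    simp only [T]
    simp only [zero_add, add_zero] at h1
    linear_combination (- X ^ (2 * j + 2) * (X ^ 2 - 1)) * h1
  have h0 : T 0 = 0 := by simp [T]
  rw [e, h0, sub_zero]
  exact Dvd.dvd.mul_left (Dvd.dvd.mul_right (pow_dvd_durfeeTerm 0 N) _) _

end TruncatedSums

/-! ### Positivity of consecutive differences of the crank series. -/

section Positivity
open PowerSeries

theorem geomProd_one_mul {k : ℕ} (h : 1 ≤ k) : geomProd 1 k * (1 - X) = geomProd 2 k := by
  simpa using geomProd_mul_one_sub le_rfl h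

theorem coeffNonneg_geomProd_mul_one_sub_or {a b c : ℕ} (ha : 1 ≤ a) (hc : c = 0 ∨ a ≤ c ∧ c ≤ b) :
    CoeffNonneg (geomProd a b * (1 - X ^ c)) := by
  rcases hc with rfl | hc
  · simpa using CoeffNonneg.zero
  · exact coeffNonneg_geomProd_mul_one_sub ha hc.1 hc.2

/-- After replacing m by m + 1, the last factor equals (1 - X³)(1 - X^(m+j+2)) + X³(1 - X^m), and
each of these binomials cancels in a denominator. The factor 1 - X is taken from 1/(q)_j if j ≥ 1,
and from 1/(q)_{m+2} if j = 0. -/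
theorem coeffNonneg_summand_of_pos {m j M : ℕ} (hm : 1 ≤ m) (hM : m + j + 7 ≤ M) :
    CoeffNonneg (geomProd 2 M * (1 - X) * (X ^ (2 * j) * durfeeTerm m j *
      (1 - X ^ (m + 2) - X ^ (j + m + 1) * (1 - X ^ 3)))) := by
  obtain ⟨m, rfl⟩ := Nat.exists_eq_add_of_le' hm
  have hE := coeffNonneg_geomProd 2 M
  have hE3 : CoeffNonneg (geomProd 2 M * (1 - X ^ 3)) :=
    coeffNonneg_geomProd_mul_one_sub (by norm_num) (by norm_num) (by omega)
  rcases Nat.eq_zero_or_pos j with rfl | hj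
  · have h1 := geomProd_one_mul (Nat.le_add_left 1 (m + 1))
    have hp : CoeffNonneg (geomProd 2 (m + 1 + 1)) := coeffNonneg_geomProd _ _
    -- Here 1 - X^m has to cancel in `geomProd 2 M`, which has no factor for 1 - X. For m = 1 the
    -- numerator is instead divided directly: (1 - X³ - X⁴ + X⁶) / ((1 - X²)(1 - X³)) = (1 + X² -
    -- X⁷) / (1 - X⁶).
    by_cases hm1 : m = 1
    · subst hm1
      have h2 : geomProd 2 (1 + 1 + 1) = geomSeries 2 * geomSeries 3 := by
        rw [geomProd_eq_mul (by norm_num), geomProd_eq_mul (by norm_num),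
          geomProd_of_lt (by norm_num), mul_one]
      have g2 := geomSeries_mul_one_sub (a := 2) (by norm_num)
      have g3 := geomSeries_mul_one_sub (a := 3) (by norm_num)
      have g6 := geomSeries_mul_one_sub (a := 6) (by norm_num)
      have key : geomSeries 2 * geomSeries 3 * (1 - X ^ 3 - X ^ 4 + X ^ 6) =
          (1 + X ^ 2 - X ^ 7) * geomSeries 6 := by
        linear_combination (- (geomSeries 2 * geomSeries 3 * (1 - X ^ 3 - X ^ 4 + X ^ 6))) * g6 +
          (1 + X ^ 2 - X ^ 7) * geomSeries 6 * geomSeries 3 * (1 - X ^ 3) * g2 +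
          (1 + X ^ 2 - X ^ 7) * geomSeries 6 * g3
      have e : geomProd 2 M * (1 - X) * (X ^ (2 * 0) * durfeeTerm (1 + 1) 0 *
          (1 - X ^ (1 + 1 + 2) - X ^ (0 + (1 + 1) + 1) * (1 - X ^ 3))) =
          X ^ 2 * (geomSeries 6 * (geomProd 2 M * (1 - X ^ 7)) +
            X ^ 2 * geomProd 2 M * geomSeries 6) := by
        rw [h2] at h1
        simp only [durfeeTerm, geomProd_of_lt zero_lt_one]
        norm_num at h1 ⊢
        linear_combination X ^ 2 * geomProd 2 M * (1 - X ^ 3 - X ^ 4 + X ^ 6) * h1 +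
          X ^ 2 * geomProd 2 M * key
      rw [e]
      exact (CoeffNonneg.X_pow _).mul (((coeffNonneg_geomSeries _).mul
        (coeffNonneg_geomProd_mul_one_sub (by norm_num) (by norm_num) (by omega))).add
        (((CoeffNonneg.X_pow _).mul hE).mul (coeffNonneg_geomSeries _)))
    · have e : geomProd 2 M * (1 - X) * (X ^ (2 * 0) * durfeeTerm (m + 1) 0 *
          (1 - X ^ (m + 1 + 2) - X ^ (0 + (m + 1) + 1) * (1 - X ^ 3))) =
          X ^ (m + 1) * ((geomProd 2 M * (1 - X ^ 3)) *
            (geomProd 2 (m + 1 + 1) * (1 - X ^ (m + 1 + 1))) +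
            X ^ 3 * (geomProd 2 M * (1 - X ^ m)) * geomProd 2 (m + 1 + 1)) := by
        rw [← h1]
        simp only [durfeeTerm, geomProd_of_lt zero_lt_one]
        ring
      rw [e]
      exact (CoeffNonneg.X_pow _).mul ((hE3.mul
        (coeffNonneg_geomProd_mul_one_sub (by norm_num) (by omega) le_rfl)).add
        (((CoeffNonneg.X_pow _).mul (coeffNonneg_geomProd_mul_one_sub_or (by norm_num)
          (by omega))).mul hp))
  · have h1 := geomProd_one_mul hj
    have e : geomProd 2 M * (1 - X) * (X ^ (2 * j) * durfeeTerm (m + 1) j *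
        (1 - X ^ (m + 1 + 2) - X ^ (j + (m + 1) + 1) * (1 - X ^ 3))) =
        X ^ (j * (j + (m + 1)) + 2 * j + (m + 1) + 2 * j) * geomProd 2 j *
          ((geomProd 2 M * (1 - X ^ 3)) *
            (geomProd 1 (m + 1 + j + 1) * (1 - X ^ (m + 1 + j + 1))) +
          X ^ 3 * geomProd 2 M * (geomProd 1 (m + 1 + j + 1) * (1 - X ^ m))) := by
      rw [← h1]
      simp only [durfeeTerm]
      ring
    rw [e]
    exact ((CoeffNonneg.X_pow _).mul (coeffNonneg_geomProd _ _)).mul ((hE3.mul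
      (coeffNonneg_geomProd_mul_one_sub le_rfl (by omega) le_rfl)).add
      (((CoeffNonneg.X_pow _).mul hE).mul
        (coeffNonneg_geomProd_mul_one_sub_or le_rfl (by omega))))

/-- The factor of the `j`-th summand for `m = 0`. -/
noncomputable def zeroFactor (j : ℕ) : PowerSeries ℤ :=
  1 + X - X ^ 3 - X ^ (j + 1) * (1 + X) * (1 - X ^ 4)

/-- For j ≥ 3 the factor is (1 - X³) + X(1 - X^j)(1 - X^(j+1)) + X(X^(j+4) + X^(j+5) - X^(2j+1)),
and each piece is handled by cancellation. For j = 2 the last bracket starts with -X⁵, so another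
decomposition is used. -/
theorem coeffNonneg_zeroFactor {j M : ℕ} (hj : 2 ≤ j) (hM : j + 7 ≤ M) :
    CoeffNonneg (geomProd 2 M * geomProd 2 j * geomProd 2 (j + 1) * zeroFactor j) := by
  have hE := coeffNonneg_geomProd 2 M
  have hE' : ∀ c, c = 0 ∨ 2 ≤ c ∧ c ≤ M → CoeffNonneg (geomProd 2 M * (1 - X ^ c)) :=
    fun c => coeffNonneg_geomProd_mul_one_sub_or (by norm_num)
  have hP := coeffNonneg_geomProd 2 j
  have hQ := coeffNonneg_geomProd 2 (j + 1)
  have hPQ := hP.mul hQ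
  have hX := CoeffNonneg.X
  have hX' := CoeffNonneg.X_pow
  have hQ' : ∀ c, 2 ≤ c ∧ c ≤ j + 1 → CoeffNonneg (geomProd 2 (j + 1) * (1 - X ^ c)) :=
    fun c h => coeffNonneg_geomProd_mul_one_sub (by norm_num) h.1 h.2
  by_cases h2 : j = 2
  · subst h2
    have e : geomProd 2 M * geomProd 2 2 * geomProd 2 (2 + 1) * zeroFactor 2 =
        geomProd 2 2 * ((geomProd 2 M * (1 - X ^ 6)) * (geomProd 2 (2 + 1) * (1 - X ^ 3)) +
          X * (geomProd 2 M * (1 - X ^ 2)) * (geomProd 2 (2 + 1) * (1 - X ^ 3)) +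
          X ^ 7 * (geomProd 2 M * (1 - X ^ 2)) * geomProd 2 (2 + 1) +
          X ^ 8 * (geomProd 2 M * geomProd 2 (2 + 1))) := by
      simp only [zeroFactor]
      ring
    rw [e]
    exact hP.mul ((((hE' _ (by omega)).mul (hQ' 3 (by omega))).add
      ((hX.mul (hE' _ (by omega))).mul (hQ' 3 (by omega)))).add
      (((hX' _).mul (hE' _ (by omega))).mul hQ) |>.add ((hX' _).mul (hE.mul hQ)))
  · have hmain : CoeffNonneg (geomProd 2 M * (1 - X ^ 3) * (geomProd 2 j * geomProd 2 (j + 1)) +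
        X * ((geomProd 2 M * (1 - X ^ j)) * (geomProd 2 (j + 1) * (1 - X ^ (j + 1)))) *
          geomProd 2 j) :=
      ((hE' _ (by omega)).mul hPQ).add
        ((hX.mul ((hE' _ (by omega)).mul (hQ' _ (by omega)))).mul hP)
    -- The term -X^(2j+1) is paired with X^(j+4), giving a factor 1 - X^(j-3). This is 1 - X, hence
    -- not cancellable, when j = 4; in that case the term cancels X^(j+5) exactly.
    have hrest : CoeffNonneg (geomProd 2 M *
        (X ^ (j + 4) + X ^ (j + 5) - X ^ (2 * j + 1))) := by
      by_cases h4 : j = 4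
      · subst h4
        have e : geomProd 2 M * (X ^ (4 + 4) + X ^ (4 + 5) - X ^ (2 * 4 + 1)) =
            X ^ 8 * geomProd 2 M := by ring
        rw [e]
        exact (hX' _).mul hE
      · obtain ⟨i, rfl⟩ := Nat.exists_eq_add_of_le' (by omega : 3 ≤ j)
        have e : geomProd 2 M * (X ^ (i + 3 + 4) + X ^ (i + 3 + 5) - X ^ (2 * (i + 3) + 1)) =
            X ^ (i + 7) * (geomProd 2 M * (1 - X ^ i)) + X ^ (i + 8) * geomProd 2 M := by ring
        rw [e]
        exact ((hX' _).mul (hE' _ (by omega))).add ((hX' _).mul hE)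
    have e : geomProd 2 M * geomProd 2 j * geomProd 2 (j + 1) * zeroFactor j =
        (geomProd 2 M * (1 - X ^ 3) * (geomProd 2 j * geomProd 2 (j + 1)) +
        X * ((geomProd 2 M * (1 - X ^ j)) * (geomProd 2 (j + 1) * (1 - X ^ (j + 1)))) *
          geomProd 2 j) + X * (geomProd 2 M *
        (X ^ (j + 4) + X ^ (j + 5) - X ^ (2 * j + 1))) * (geomProd 2 j * geomProd 2 (j + 1)) := by
      simp only [zeroFactor]
      ring
    rw [e]
    exact hmain.add ((hX.mul hrest).mul hPQ)

/-- The two factors 1 - X are absorbed by 1/(q)_j and 1/(q)_{j+1}; for j = 0 the first of these is 1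
and absorbs nothing. -/
theorem zero_summand_eq {j M : ℕ} (hj : 1 ≤ j) :
    geomProd 2 M * (1 - X) * ((1 - X) * (X ^ (3 * j) * durfeeTerm 0 j * zeroFactor j)) =
      X ^ (j * j + 5 * j) * (geomProd 2 M * geomProd 2 j * geomProd 2 (j + 1) * zeroFactor j) := by
  rw [← geomProd_one_mul hj, ← geomProd_one_mul (Nat.le_add_left 1 j)]
  simp only [durfeeTerm, add_zero, zero_add]
  ring

/-- The summands `j = 0` and `j = 1` for `m = 0`. -/
theorem coeffNonneg_first_two {M : ℕ} (hM : 9 ≤ M) :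
    CoeffNonneg (geomProd 2 M * (1 - X) * ((1 - X) * (X ^ (3 * 0) * durfeeTerm 0 0 * zeroFactor 0)) +
      geomProd 2 M * (1 - X) * ((1 - X) * (X ^ (3 * 1) * durfeeTerm 0 1 * zeroFactor 1)) -
      (1 - X) * geomProd 4 M) := by
  have h2 : geomProd 2 (1 + 1) = geomSeries 2 := by
    rw [geomProd_eq_mul (by norm_num), geomProd_of_lt (by norm_num), mul_one]
  have h1 : geomProd 2 1 = 1 := geomProd_of_lt (by norm_num)
  have h0 := geomProd_one_mul (k := 1) le_rfl
  rw [h1] at h0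
  have g2 := geomSeries_mul_one_sub (a := 2) (by norm_num)
  have e4 : geomProd 4 M = geomProd 2 M * (1 - X ^ 2) * (1 - X ^ 3) := by
    rw [geomProd_mul_one_sub (by norm_num) (by omega),
      geomProd_mul_one_sub (by norm_num) (by omega)]
  rw [zero_summand_eq le_rfl, h1, h2, e4]
  -- The summand j = 0 is (1 - X)(1 - X² - X³ + X⁵ + X⁶) times the product. Subtracting (1 - X)(1 -
  -- X²)(1 - X³) times the product leaves (1 - X) X⁶, which the summand j = 1, also of order X⁶,
  -- compensates.
  have e : geomProd 2 M * (1 - X) * ((1 - X) * (X ^ (3 * 0) * durfeeTerm 0 0 * zeroFactor 0)) +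
      X ^ (1 * 1 + 5 * 1) * (geomProd 2 M * 1 * geomSeries 2 * zeroFactor 1) -
      (1 - X) * (geomProd 2 M * (1 - X ^ 2) * (1 - X ^ 3)) =
      X ^ 6 * ((geomProd 2 M * (1 - X ^ 3)) + (geomProd 2 M * (1 - X ^ 5)) +
        X ^ 6 * geomSeries 2 * geomProd 2 M) := by
    simp only [durfeeTerm, zeroFactor, geomProd_of_lt zero_lt_one]
    norm_num
    linear_combination (geomProd 2 M * (1 - X) * (1 - X ^ 2 - X ^ 3 + X ^ 5 + X ^ 6)) * h0 +
      (X ^ 6 * geomProd 2 M * (1 - X ^ 3 + X - X ^ 5)) * g2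
  rw [e]
  exact (CoeffNonneg.X_pow _).mul (((coeffNonneg_geomProd_mul_one_sub (by norm_num) (by norm_num)
    (by omega)).add (coeffNonneg_geomProd_mul_one_sub (by norm_num) (by norm_num)
    (by omega))).add (((CoeffNonneg.X_pow _).mul (coeffNonneg_geomSeries _)).mul
    (coeffNonneg_geomProd _ _)))

/-- Modulo `X ^ N`, consecutive differences for `m ≥ 1` have nonnegative coefficients. -/
theorem exists_coeffNonneg_crankSum_sub {m : ℕ} (hm : 1 ≤ m) (N : ℕ) :
    ∃ f, CoeffNonneg f ∧ X ^ N ∣ crankSum m N - crankSum (m + 1) N - f := by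
  refine ⟨_, ?_, dvd_crankSum_sub_crankSum (M := m + N + 7) (by omega) (by omega)⟩
  refine CoeffNonneg.sum fun j hj => coeffNonneg_summand_of_pos hm ?_
  have := Finset.mem_range.1 hj
  omega

/-- The factor 1 - X cancels in 1/(q)_k for every k ≥ 1. The terms k = 0 and k = 1 give 1 - X and
X⁴; keeping X⁴ is essential for the later multiplication by B². -/
theorem coeffNonneg_eulerSum_four {N : ℕ} (hN : 2 ≤ N) :
    CoeffNonneg ((1 - X) * eulerSum 4 N - (1 - X + X ^ 4)) := by
  obtain ⟨N, rfl⟩ := Nat.exists_eq_add_of_le' hN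
  have h0 := geomProd_one_mul (k := 1) le_rfl
  rw [geomProd_of_lt one_lt_two] at h0
  have e : (1 - X) * eulerSum 4 (N + 2) - (1 - X + X ^ 4) =
      ∑ k ∈ Finset.range N, X ^ (4 * (k + 2)) * geomProd 2 (k + 2) := by
    rw [eulerSum, Finset.sum_range_succ', Finset.sum_range_succ']
    simp only [← geomProd_one_mul (Nat.le_add_left 1 _), geomProd_of_lt zero_lt_one, add_assoc,
      Nat.reduceAdd, ← mul_assoc, ← Finset.sum_mul]
    norm_num
    linear_combination X ^ 4 * h0
  rw [e]
  exact CoeffNonneg.sum fun k _ => (CoeffNonneg.X_pow _).mul (coeffNonneg_geomProd _ _)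

/-- The nonnegative series collects the summands j ≥ 2, the first two summands less (1 - X)
`geomProd 4 M`, and what remains of that product after Euler's expansion. The -X is genuine: C_0 -
C_1 has coefficient -1 in degree 1. -/
theorem exists_coeffNonneg_crankSum_zero {N : ℕ} (hN : 2 ≤ N) :
    ∃ f, CoeffNonneg f ∧ X ^ N ∣ crankSum 0 N - crankSum 1 N - (1 - X + X ^ 4 + f) := by
  let M := N + 9
  have hd1 := dvd_crankSum_sub_crankSum (m := 0) (N := N) (M := M) (by omega) (by omega)
  have hd2 := Dvd.dvd.mul_left (dvd_sum_durfeeTerm_zero N) (geomProd 2 M * (1 - X))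
  have hd3 := Dvd.dvd.mul_left (dvd_eulerSum_sub_geomProd (a := 4) (N := N) (M := M) (by norm_num)
    (by omega) (by omega)) (1 - X)
  let F : ℕ → PowerSeries ℤ := fun j =>
    geomProd 2 M * (1 - X) * ((1 - X) * (X ^ (3 * j) * durfeeTerm 0 j * zeroFactor j))
  obtain ⟨K, rfl⟩ := Nat.exists_eq_add_of_le' hN
  have hsum : CoeffNonneg (∑ j ∈ Finset.range K, F (j + 2)) := by
    refine CoeffNonneg.sum fun j hj => ?_
    have := Finset.mem_range.1 hj
    simp only [F]
    rw [zero_summand_eq (by omega)]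
    exact (CoeffNonneg.X_pow _).mul (coeffNonneg_zeroFactor (by omega) (by omega))
  refine ⟨_, (hsum.add (coeffNonneg_first_two (M := M) (by omega))).add
    (coeffNonneg_eulerSum_four hN), ?_⟩
  have hF : geomProd 2 M * (1 - X) * ∑ j ∈ Finset.range (K + 2), (1 - X) * (X ^ (3 * j) *
      durfeeTerm 0 j * (1 + X - X ^ 3 - X ^ (j + 1) * (1 + X) * (1 - X ^ 4))) =
      ∑ j ∈ Finset.range K, F (j + 2) + F 1 + F 0 := by
    rw [Finset.mul_sum]
    exact (Finset.sum_range_succ' F (K + 1)).trans (by rw [Finset.sum_range_succ' _ K])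
  rw [mul_sub, hF] at hd2
  simp only [zero_add, add_zero, ← Finset.mul_sum] at hd1
  have h := dvd_sub (dvd_add hd1 hd2) hd3
  convert h using 1
  simp only [F]
  ring

end Positivity

/-! ### Partitions with restricted part sizes. -/

section RestrictedPartitions
open PowerSeries

/-- The generating function of partitions into parts satisfying `p`. -/
noncomputable def restrictedSeries (p : ℕ → Prop) [DecidablePred p] : PowerSeries ℤ :=
  mk fun n => ((Nat.Partition.restricted n p).card : ℤ)

theorem coeffNonneg_restrictedSeries (p : ℕ → Prop) [DecidablePred p] :
    CoeffNonneg (restrictedSeries p) := fun n => by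
  rw [restrictedSeries, coeff_mk]; exact Int.natCast_nonneg _

theorem card_restricted_filter_mem (p : ℕ → Prop) [DecidablePred p] {a : ℕ} (ha : 1 ≤ a)
    (hpa : p a) (n : ℕ) :
    ((Nat.Partition.restricted n p).filter fun l => a ∈ l.parts).card =
      if a ≤ n then (Nat.Partition.restricted (n - a) p).card else 0 := by
  split_ifs with h
  · let e := Nat.Partition.partitionWithPartEquiv ha h
    symm
    refine Finset.card_bij (fun l _ => (e.symm l).1) ?_ ?_ ?_
    · intro l hl
      simp only [Nat.Partition.restricted, Finset.mem_filter, Finset.mem_univ, true_and] at hl ⊢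
      refine ⟨?_, (e.symm l).2⟩
      simp only [e, Nat.Partition.partitionWithPartEquiv_symm_apply_parts]
      intro i hi
      rcases Multiset.mem_cons.1 hi with rfl | hi
      · exact hpa
      · exact hl i hi
    · intro l _ l' _ hll
      exact e.symm.injective (Subtype.ext hll)
    · intro l hl
      simp only [Nat.Partition.restricted, Finset.mem_filter, Finset.mem_univ, true_and] at hl
      refine ⟨e ⟨l, hl.2⟩, ?_, by simp⟩
      simp only [Nat.Partition.restricted, Finset.mem_filter, Finset.mem_univ, true_and, e,
        Nat.Partition.partitionWithPartEquiv_apply_parts]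
      exact fun i hi => hl.1 i (Multiset.mem_of_mem_erase hi)
  · rw [Finset.card_eq_zero, Finset.filter_eq_empty_iff]
    exact fun l _ hal => h (l.le_of_mem_parts hal)

theorem restrictedSeries_mul_one_sub (p : ℕ → Prop) [DecidablePred p] {a : ℕ} (ha : 1 ≤ a)
    (hpa : p a) :
    restrictedSeries p * (1 - X ^ a) = restrictedSeries fun i => p i ∧ i ≠ a := by
  ext n
  rw [mul_sub, mul_one, map_sub, coeff_mul_X_pow', restrictedSeries, restrictedSeries, coeff_mk,
    coeff_mk, ← Finset.card_filter_add_card_filter_not (s := Nat.Partition.restricted n p)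
      (fun l => a ∈ l.parts),
    card_restricted_filter_mem p ha hpa]
  have e : (Nat.Partition.restricted n p).filter (fun l => a ∉ l.parts) =
      Nat.Partition.restricted n fun i => p i ∧ i ≠ a := by
    ext l
    simp only [Nat.Partition.restricted, Finset.mem_filter, Finset.mem_univ, true_and]
    exact ⟨fun h i hi => ⟨h.1 i hi, fun hia => h.2 (hia ▸ hi)⟩,
      fun h => ⟨fun i hi => (h i hi).1, fun hal => (h a hal).2 rfl⟩⟩
  rw [e]
  split_ifs <;> simp

/-- The indicator series of the positive integers satisfying `p`. -/
noncomputable def partSeries (p : ℕ → Prop) [DecidablePred p] : PowerSeries ℤ :=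
  mk fun a => if 1 ≤ a ∧ p a then 1 else 0

theorem coeffNonneg_partSeries (p : ℕ → Prop) [DecidablePred p] :
    CoeffNonneg (partSeries p) := fun n => by
  rw [partSeries, coeff_mk]; split_ifs <;> norm_num

theorem coeff_zero_restrictedSeries (p : ℕ → Prop) [DecidablePred p] :
    coeff 0 (restrictedSeries p) = 1 := by
  rw [restrictedSeries, coeff_mk]
  have : Nat.Partition.restricted 0 p = Finset.univ := by
    ext l; simp [Nat.Partition.restricted]
  rw [this]
  simp

/-- Removing one part from a nonempty partition. -/
theorem coeffNonneg_one_add_partSeries_mul (p : ℕ → Prop) [DecidablePred p] :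
    CoeffNonneg (1 + partSeries p * restrictedSeries p - restrictedSeries p) := fun n => by
  rcases Nat.eq_zero_or_pos n with rfl | hn
  · rw [map_sub, map_add, coeff_zero_restrictedSeries, coeff_zero_one]
    have := (coeffNonneg_partSeries p).mul (coeffNonneg_restrictedSeries p) 0
    linarith
  · rw [map_sub, map_add, coeff_one, if_neg hn.ne', zero_add, coeff_mul,
      Finset.Nat.sum_antidiagonal_eq_sum_range_succ_mk, sub_nonneg]
    -- Only a union bound is needed: a partition is counted once for each distinct part size.
    have hsub : Nat.Partition.restricted n p ⊆ ((Finset.range (n + 1)).filter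
        fun a => 1 ≤ a ∧ p a).biUnion
        fun a => (Nat.Partition.restricted n p).filter fun l => a ∈ l.parts := by
      intro l hl
      have hl0 : l.parts ≠ 0 := fun h => by
        have := l.parts_sum
        rw [h, Multiset.sum_zero] at this
        omega
      obtain ⟨a, ha⟩ := Multiset.exists_mem_of_ne_zero hl0
      have hl' := hl
      simp only [Nat.Partition.restricted, Finset.mem_filter, Finset.mem_univ, true_and] at hl'
      simp only [Finset.mem_biUnion, Finset.mem_filter, Finset.mem_range]
      exact ⟨a, ⟨Nat.lt_succ_of_le (l.le_of_mem_parts ha), l.parts_pos ha, hl' a ha⟩, hl, ha⟩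
    have hcard := (Finset.card_le_card hsub).trans Finset.card_biUnion_le
    rw [restrictedSeries, coeff_mk]
    refine (Int.ofNat_le.2 hcard).trans (le_of_eq ?_)
    rw [Finset.sum_filter, Nat.cast_sum]
    refine Finset.sum_congr rfl fun a ha => ?_
    have han : a ≤ n := Nat.lt_succ_iff.1 (Finset.mem_range.1 ha)
    simp only [partSeries, coeff_mk]
    split_ifs with h
    · rw [card_restricted_filter_mem p h.1 h.2, if_pos han, one_mul]
    · simp

theorem coeffNonneg_restrictedSeries_sub_one (p : ℕ → Prop) [DecidablePred p] :
    CoeffNonneg (restrictedSeries p - 1) := fun n => by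
  rw [map_sub, coeff_one]
  split_ifs with h
  · rw [h, coeff_zero_restrictedSeries, sub_self]
  · rw [sub_zero]; exact coeffNonneg_restrictedSeries p n

/-- Squared form of R ≤ 1 + AR, with A the series of part sizes; it also uses R ≥ 1. -/
theorem coeffNonneg_one_add_partSeries_mul_sq (p : ℕ → Prop) [DecidablePred p] :
    CoeffNonneg (1 + 2 * partSeries p * restrictedSeries p ^ 2 - restrictedSeries p ^ 2) := by
  have hR := coeffNonneg_restrictedSeries p
  have e : 1 + 2 * partSeries p * restrictedSeries p ^ 2 - restrictedSeries p ^ 2 =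
      (1 + partSeries p * restrictedSeries p - restrictedSeries p) * (1 + restrictedSeries p) +
        partSeries p * restrictedSeries p * (restrictedSeries p - 1) := by ring
  rw [e]
  exact ((coeffNonneg_one_add_partSeries_mul p).mul (CoeffNonneg.one.add hR)).add
    (((coeffNonneg_partSeries p).mul hR).mul (coeffNonneg_restrictedSeries_sub_one p))

/-! ### Absorbing the term -q by the square of the β-series. -/

/-- The series `(1 - q + q⁴) / ((1 - q²)² (1 - q³)²)`. -/
noncomputable def smallSeries : PowerSeries ℤ :=
  (1 - X + X ^ 4) * geomSeries 2 ^ 2 * geomSeries 3 ^ 2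

/-- Multiplication by 1 - X⁶ gives -X plus a nonnegative series, and the -X is not seen in degrees
at least 6. -/
theorem coeff_smallSeries_le (n : ℕ) : coeff n smallSeries ≤ coeff (n + 6) smallSeries := by
  have g1 := geomSeries_mul_one_sub (a := 1) le_rfl
  have g2 := geomSeries_mul_one_sub (a := 2) (by norm_num)
  have g3 := geomSeries_mul_one_sub (a := 3) (by norm_num)
  have g6 := geomSeries_mul_one_sub (a := 6) (by norm_num)
  -- This holds because 1 - X⁶ = (1 - X³)(1 + X)(1 - X + X²).
  have e1 : (1 - X) * geomSeries 2 * geomSeries 3 = (1 - X + X ^ 2) * geomSeries 6 := by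
    linear_combination (-((1 - X) * geomSeries 2 * geomSeries 3)) * g6 +
      (1 - X + X ^ 2) * geomSeries 6 * geomSeries 3 * (1 - X ^ 3) * g2 +
      (1 - X + X ^ 2) * geomSeries 6 * g3
  have e2 : (1 - X + X ^ 2) * geomSeries 2 * geomSeries 3 =
      (1 - X + 2 * X ^ 2 + X ^ 4 * geomSeries 1) * geomSeries 6 := by
    linear_combination (-((1 - X + X ^ 2) * geomSeries 2 * geomSeries 3)) * g1 +
      (1 - X + X ^ 2) * geomSeries 1 * e1 + (1 - X + 2 * X ^ 2) * geomSeries 6 * g1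
  have e3 : smallSeries * (1 - X ^ 6) + X = geomSeries 6 * (1 + X ^ 2 + X ^ 2 + X ^ 4 + X ^ 5 +
      X ^ 6 + X ^ 8 * geomSeries 1) +
      X ^ 4 * (geomSeries 2 * geomSeries 3 ^ 2 * (1 + X ^ 2 + X ^ 4)) := by
    rw [smallSeries]
    linear_combination geomSeries 2 * geomSeries 3 * (1 - X ^ 6) * e1 + e2 +
      (1 - X + X ^ 2) * geomSeries 2 * geomSeries 3 * g6 +
      (X ^ 4 + X ^ 5 + X ^ 6 + X ^ 7) * geomSeries 6 * g1 - X * g6 +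
      X ^ 4 * geomSeries 2 * geomSeries 3 ^ 2 * (1 + X ^ 2 + X ^ 4) * g2
  have hX := CoeffNonneg.X_pow
  have hg := coeffNonneg_geomSeries
  have hnn : CoeffNonneg (smallSeries * (1 - X ^ 6) + X) := by
    rw [e3]
    exact ((hg 6).mul ((((((CoeffNonneg.one.add (hX 2)).add (hX 2)).add (hX 4)).add (hX 5)).add
      (hX 6)).add ((hX 8).mul (hg 1)))).add ((hX 4).mul (((hg 2).mul ((hg 3).pow 2)).mul
      ((CoeffNonneg.one.add (hX 2)).add (hX 4))))
  have h := hnn (n + 6)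
  rw [map_add, mul_sub, map_sub, mul_one, coeff_mul_X_pow, coeff_X, if_neg (by omega)] at h
  linarith

/-- The recurrence encoded by the denominator (1 - X²)²(1 - X³)² = 1 - 2X² - 2X³ + X⁴ + 4X⁵ + X⁶ -
2X⁷ - 2X⁸ + X¹⁰. -/
theorem coeff_smallSeries_rec (n : ℕ) :
    coeff n smallSeries = coeff n (1 - X + X ^ 4 : PowerSeries ℤ) +
      2 * (if 2 ≤ n then coeff (n - 2) smallSeries else 0) +
      2 * (if 3 ≤ n then coeff (n - 3) smallSeries else 0) -
      (if 4 ≤ n then coeff (n - 4) smallSeries else 0) -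
      4 * (if 5 ≤ n then coeff (n - 5) smallSeries else 0) -
      (if 6 ≤ n then coeff (n - 6) smallSeries else 0) +
      2 * (if 7 ≤ n then coeff (n - 7) smallSeries else 0) +
      2 * (if 8 ≤ n then coeff (n - 8) smallSeries else 0) -
      (if 10 ≤ n then coeff (n - 10) smallSeries else 0) := by
  have g2 := geomSeries_mul_one_sub (a := 2) (by norm_num)
  have g3 := geomSeries_mul_one_sub (a := 3) (by norm_num)
  have e : smallSeries = (1 - X + X ^ 4) + (smallSeries * X ^ 2 + smallSeries * X ^ 2) +
      (smallSeries * X ^ 3 + smallSeries * X ^ 3) - smallSeries * X ^ 4 -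
      (smallSeries * X ^ 5 + smallSeries * X ^ 5 + smallSeries * X ^ 5 + smallSeries * X ^ 5) -
      smallSeries * X ^ 6 + (smallSeries * X ^ 7 + smallSeries * X ^ 7) +
      (smallSeries * X ^ 8 + smallSeries * X ^ 8) - smallSeries * X ^ 10 := by
    have h2 : (geomSeries 2 * (1 - X ^ 2)) ^ 2 = 1 := by rw [g2, one_pow]
    have h3 : (geomSeries 3 * (1 - X ^ 3)) ^ 2 = 1 := by rw [g3, one_pow]
    rw [smallSeries]
    linear_combination (1 - X + X ^ 4) * h3 +
      (1 - X + X ^ 4) * (geomSeries 3 * (1 - X ^ 3)) ^ 2 * h2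
  have h := congrArg (coeff n) e
  simp only [map_add, map_sub, coeff_mul_X_pow'] at h
  rw [h]
  simp only [map_add, map_sub]
  ring

theorem coeff_smallSeries_values :
    coeff 0 smallSeries = 1 ∧ coeff 1 smallSeries = -1 ∧ coeff 2 smallSeries = 2 ∧
    coeff 3 smallSeries = 0 ∧ coeff 4 smallSeries = 2 ∧ coeff 5 smallSeries = 1 ∧
    coeff 6 smallSeries = 5 ∧ coeff 7 smallSeries = 1 ∧ coeff 8 smallSeries = 8 ∧
    coeff 9 smallSeries = 5 ∧ coeff 10 smallSeries = 10 ∧ coeff 11 smallSeries = 9 ∧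
    coeff 12 smallSeries = 17 ∧ coeff 13 smallSeries = 12 ∧ coeff 14 smallSeries = 24 ∧
    coeff 15 smallSeries = 21 ∧ coeff 16 smallSeries = 30 ∧ coeff 17 smallSeries = 30 := by
  have h0 : coeff 0 smallSeries = 1 := by
    rw [coeff_smallSeries_rec]; simp
  have h1 : coeff 1 smallSeries = -1 := by
    rw [coeff_smallSeries_rec]; simp [coeff_one, coeff_X, coeff_X_pow]
  have h2 : coeff 2 smallSeries = 2 := by
    rw [coeff_smallSeries_rec]; simp [coeff_one, coeff_X, coeff_X_pow, *]
  have h3 : coeff 3 smallSeries = 0 := by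
    rw [coeff_smallSeries_rec]; simp [coeff_one, coeff_X, coeff_X_pow, *]
  have h4 : coeff 4 smallSeries = 2 := by
    rw [coeff_smallSeries_rec]; simp [coeff_one, coeff_X, coeff_X_pow, *]
  have h5 : coeff 5 smallSeries = 1 := by
    rw [coeff_smallSeries_rec]; simp [coeff_one, coeff_X, coeff_X_pow, *]
  have h6 : coeff 6 smallSeries = 5 := by
    rw [coeff_smallSeries_rec]; simp [coeff_one, coeff_X, coeff_X_pow, *]
  have h7 : coeff 7 smallSeries = 1 := by
    rw [coeff_smallSeries_rec]; simp [coeff_one, coeff_X, coeff_X_pow, *]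
  have h8 : coeff 8 smallSeries = 8 := by
    rw [coeff_smallSeries_rec]; simp [coeff_one, coeff_X, coeff_X_pow, *]
  have h9 : coeff 9 smallSeries = 5 := by
    rw [coeff_smallSeries_rec]; simp [coeff_one, coeff_X, coeff_X_pow, *]
  have h10 : coeff 10 smallSeries = 10 := by
    rw [coeff_smallSeries_rec]; simp [coeff_one, coeff_X, coeff_X_pow, *]
  have h11 : coeff 11 smallSeries = 9 := by
    rw [coeff_smallSeries_rec]; simp [coeff_one, coeff_X, coeff_X_pow, *]
  have h12 : coeff 12 smallSeries = 17 := by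
    rw [coeff_smallSeries_rec]; simp [coeff_one, coeff_X, coeff_X_pow, *]
  have h13 : coeff 13 smallSeries = 12 := by
    rw [coeff_smallSeries_rec]; simp [coeff_one, coeff_X, coeff_X_pow, *]
  have h14 : coeff 14 smallSeries = 24 := by
    rw [coeff_smallSeries_rec]; simp [coeff_one, coeff_X, coeff_X_pow, *]
  have h15 : coeff 15 smallSeries = 21 := by
    rw [coeff_smallSeries_rec]; simp [coeff_one, coeff_X, coeff_X_pow, *]
  have h16 : coeff 16 smallSeries = 30 := by
    rw [coeff_smallSeries_rec]; simp [coeff_one, coeff_X, coeff_X_pow, *]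
  have h17 : coeff 17 smallSeries = 30 := by
    rw [coeff_smallSeries_rec]; simp [coeff_one, coeff_X, coeff_X_pow, *]
  exact ⟨h0, h1, h2, h3, h4, h5, h6, h7, h8, h9, h10, h11, h12, h13, h14, h15, h16, h17⟩

theorem six_le_coeff_smallSeries (n : ℕ) : 6 ≤ coeff (n + 12) smallSeries := by
  induction n using Nat.strong_induction_on with
  | _ n ih =>
    by_cases h : n < 6
    · obtain ⟨-, -, -, -, -, -, -, -, -, -, -, -, h12, h13, h14, h15, h16, h17⟩ :=
        coeff_smallSeries_values
      interval_cases n <;> norm_num [h12, h13, h14, h15, h16, h17]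
    · obtain ⟨k, rfl⟩ := Nat.exists_eq_add_of_le' (not_lt.1 h)
      have h1 := ih k (by omega)
      have h2 := coeff_smallSeries_le (k + 12)
      rw [show k + 6 + 12 = k + 12 + 6 by ring]
      exact h1.trans h2

theorem coeff_partSeries_le_one (p : ℕ → Prop) [DecidablePred p] (n : ℕ) :
    coeff n (partSeries p) ≤ 1 := by
  rw [partSeries, coeff_mk]; split_ifs <;> norm_num

/-- If no part is `1, 2, 3, 5, 7`, then `smallSeries` dominates a series made from `p`. -/
theorem coeffNonneg_smallSeries_sub (p : ℕ → Prop) [DecidablePred p]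
    (hp : ∀ i, 1 ≤ i → p i → 4 ≤ i ∧ i ≠ 5 ∧ i ≠ 7) :
    CoeffNonneg (smallSeries + (X + X ^ 5 + X ^ 7) -
      (partSeries p + partSeries p) * (X + X ^ 5 + X ^ 7)) := fun n => by
  have hle := coeff_partSeries_le_one p
  have h0 : ∀ i, ¬ (4 ≤ i ∧ i ≠ 5 ∧ i ≠ 7) → coeff i (partSeries p) = 0 := fun i hi => by
    rw [partSeries, coeff_mk, if_neg fun h => hi (hp i h.1 h.2)]
  have e : (partSeries p + partSeries p) * (X + X ^ 5 + X ^ 7) =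
      (partSeries p * X ^ 1 + partSeries p * X ^ 1) + (partSeries p * X ^ 5 + partSeries p * X ^ 5) +
      (partSeries p * X ^ 7 + partSeries p * X ^ 7) := by ring
  rw [e]
  simp only [map_add, map_sub, coeff_mul_X_pow', coeff_X, coeff_X_pow]
  by_cases hn : n < 12
  -- The bound is attained in degree 1, and in degrees 5 and 7 if 4 and 6 are allowed parts: the
  -- correction X + X⁵ + X⁷ is just large enough there.
  · obtain ⟨v0, v1, v2, v3, v4, v5, v6, v7, v8, v9, v10, v11, -⟩ := coeff_smallSeries_values
    have z0 := h0 0 (by norm_num)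
    have z1 := h0 1 (by norm_num)
    have z2 := h0 2 (by norm_num)
    have z3 := h0 3 (by norm_num)
    have z5 := h0 5 (by norm_num)
    have z7 := h0 7 (by norm_num)
    have l4 := hle 4
    have l6 := hle 6
    have l8 := hle 8
    have l9 := hle 9
    have l10 := hle 10
    interval_cases n <;> norm_num [*] <;> linarith
  -- From degree 12 on, the subtracted series has coefficients at most 2 · 3 = 6.
  · obtain ⟨k, rfl⟩ := Nat.exists_eq_add_of_le' (not_lt.1 hn)
    have h6 := six_le_coeff_smallSeries k
    have l1 := hle (k + 12 - 1)
    have l5 := hle (k + 12 - 5)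
    have l7 := hle (k + 12 - 7)
    rw [if_neg (by omega), if_neg (by omega), if_neg (by omega), if_pos (by omega),
      if_pos (by omega), if_pos (by omega)]
    linarith

/-- Being a part size not congruent to `±1` modulo `6`. -/
def IsBetaPart (i : ℕ) : Prop := ¬ (i : ℤ) ≡ 1 [ZMOD 6] ∧ ¬ (i : ℤ) ≡ -1 [ZMOD 6]

instance : DecidablePred IsBetaPart := fun _ => inferInstanceAs (Decidable (_ ∧ _))

theorem isBetaPart_iff (i : ℕ) : IsBetaPart i ↔ i % 6 ≠ 1 ∧ i % 6 ≠ 5 := by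
  unfold IsBetaPart Int.ModEq
  omega

/-- Removing the parts 2 and 3 gives B = R / ((1 - X²)(1 - X³)), where R has smallest part 4. With P
= X + X⁵ + X⁷ and S = `smallSeries`, S R² + P = (S + P - 2AP) R² + P(1 + 2AR² - R²), and both terms
are nonnegative. -/
theorem coeffNonneg_mul_betaSeries_sq :
    CoeffNonneg ((1 - X + X ^ 4) * restrictedSeries IsBetaPart ^ 2 + (X + X ^ 5 + X ^ 7)) := by
  have h2 := restrictedSeries_mul_one_sub IsBetaPart (a := 2) (by norm_num)
    ((isBetaPart_iff 2).2 (by norm_num))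
  have h3 := restrictedSeries_mul_one_sub (fun i => IsBetaPart i ∧ i ≠ 2) (a := 3) (by norm_num)
    ⟨(isBetaPart_iff 3).2 (by norm_num), by norm_num⟩
  rw [← h2] at h3
  set R := restrictedSeries fun i => (IsBetaPart i ∧ i ≠ 2) ∧ i ≠ 3 with hR
  set A := partSeries fun i => (IsBetaPart i ∧ i ≠ 2) ∧ i ≠ 3 with hA
  have hsq := coeffNonneg_one_add_partSeries_mul_sq fun i => (IsBetaPart i ∧ i ≠ 2) ∧ i ≠ 3
  rw [← hA, ← hR] at hsq
  have hsm := coeffNonneg_smallSeries_sub (fun i => (IsBetaPart i ∧ i ≠ 2) ∧ i ≠ 3)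
    (fun i _ hi => by rw [isBetaPart_iff] at hi; omega)
  rw [← hA] at hsm
  have g2 := geomSeries_mul_one_sub (a := 2) (by norm_num)
  have g3 := geomSeries_mul_one_sub (a := 3) (by norm_num)
  have hb : restrictedSeries IsBetaPart = geomSeries 2 * geomSeries 3 * R := by
    rw [← h3]
    linear_combination (- restrictedSeries IsBetaPart * geomSeries 3 * (1 - X ^ 3)) * g2 -
      restrictedSeries IsBetaPart * g3
  have e : (1 - X + X ^ 4) * restrictedSeries IsBetaPart ^ 2 + (X + X ^ 5 + X ^ 7) =
      (smallSeries + (X + X ^ 5 + X ^ 7) - (A + A) * (X + X ^ 5 + X ^ 7)) * R ^ 2 +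
      (X + X ^ 5 + X ^ 7) * (1 + 2 * A * R ^ 2 - R ^ 2) := by
    rw [hb, smallSeries]
    ring
  rw [e]
  exact (hsm.mul ((coeffNonneg_restrictedSeries _).pow 2)).add
    (((CoeffNonneg.X.add (CoeffNonneg.X_pow 5)).add (CoeffNonneg.X_pow 7)).mul hsq)

end RestrictedPartitions

/-! ### Partitions with a given number of parts. -/

section PartitionsByLength
open PowerSeries

/-- The generating function of partitions with exactly `k` parts. -/
noncomputable def lengthSeries (k : ℕ) : PowerSeries ℤ :=
  mk fun n => ((Finset.univ.filter fun l : n.Partition => l.parts.card = k).card : ℤ)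

theorem card_length_filter_one_mem (k n : ℕ) :
    (Finset.univ.filter fun l : n.Partition => l.parts.card = k + 1 ∧ 1 ∈ l.parts).card =
      if 1 ≤ n then (Finset.univ.filter fun l : (n - 1).Partition => l.parts.card = k).card
      else 0 := by
  split_ifs with h
  · let e := Nat.Partition.partitionWithPartEquiv le_rfl h
    symm
    refine Finset.card_bij (fun l _ => (e.symm l).1) ?_ ?_ ?_
    · intro l hl
      simp only [Finset.mem_filter, Finset.mem_univ, true_and] at hl ⊢
      exact ⟨by simp [e, hl], (e.symm l).2⟩
    · intro l _ l' _ hll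
      exact e.symm.injective (Subtype.ext hll)
    · intro l hl
      simp only [Finset.mem_filter, Finset.mem_univ, true_and] at hl
      refine ⟨e ⟨l, hl.2⟩, ?_, by simp⟩
      simp [e, Multiset.card_erase_of_mem hl.2, hl.1]
  · rw [Finset.card_eq_zero, Finset.filter_eq_empty_iff]
    exact fun l _ hl => h (l.le_of_mem_parts hl.2)

theorem card_length_filter_one_notMem (k n : ℕ) :
    (Finset.univ.filter fun l : n.Partition => l.parts.card = k ∧ 1 ∉ l.parts).card =
      if k ≤ n then (Finset.univ.filter fun l : (n - k).Partition => l.parts.card = k).card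
      else 0 := by
  have hsum : ∀ s : Multiset ℕ, (s.map (· + 1)).sum = s.sum + s.card := fun s => by
    simp [Multiset.sum_map_add]
  have hpred : ∀ s : Multiset ℕ, (∀ i ∈ s, 0 < i) → (s.map (· - 1)).map (· + 1) = s := by
    intro s hs
    rw [Multiset.map_map]
    refine (Multiset.map_congr rfl fun i hi => ?_).trans (Multiset.map_id s)
    have := hs i hi
    simp only [Function.comp, id]
    omega
  split_ifs with h
  · symm
    refine Finset.card_bij (fun l hl => ⟨l.parts.map (· + 1), by simp +contextual, ?_⟩) ?_ ?_ ?_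
    · simp only [Finset.mem_filter, Finset.mem_univ, true_and] at hl
      rw [hsum, l.parts_sum, hl]
      omega
    · intro l hl
      simp only [Finset.mem_filter, Finset.mem_univ, true_and] at hl ⊢
      refine ⟨by simpa using hl, fun h1 => ?_⟩
      obtain ⟨i, hi, hi1⟩ := Multiset.mem_map.1 h1
      have := l.parts_pos hi
      omega
    · intro l _ l' _ hll
      have := congrArg Nat.Partition.parts hll
      exact Nat.Partition.ext (Multiset.map_injective (add_left_injective 1) this)
    · intro l hl
      simp only [Finset.mem_filter, Finset.mem_univ, true_and] at hl
      have hp := hpred l.parts fun i hi => l.parts_pos hi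
      refine ⟨⟨l.parts.map (· - 1), fun {i} hi => ?_, ?_⟩, ?_, ?_⟩
      · obtain ⟨j, hj, rfl⟩ := Multiset.mem_map.1 hi
        have h0 := l.parts_pos hj
        have h1 : j ≠ 1 := fun h1 => hl.2 (h1 ▸ hj)
        omega
      · have := hsum (l.parts.map (· - 1))
        rw [hp, l.parts_sum, Multiset.card_map, hl.1] at this
        omega
      · simpa using hl.1
      · exact Nat.Partition.ext hp
  · rw [Finset.card_eq_zero, Finset.filter_eq_empty_iff]
    intro l _ hl
    have := hsum (l.parts.map (· - 1))
    rw [hpred l.parts fun i hi => l.parts_pos hi, l.parts_sum, Multiset.card_map, hl.1] at this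
    omega

/-- A partition into k + 1 parts either contains a 1, which is deleted, or has all parts at least 2,
and then every part is lowered by 1. -/
theorem lengthSeries_succ (k : ℕ) :
    lengthSeries (k + 1) * (1 - X ^ (k + 1)) = lengthSeries k * X := by
  ext n
  rw [mul_sub, mul_one, map_sub, coeff_mul_X_pow', ← pow_one X, coeff_mul_X_pow', lengthSeries,
    lengthSeries, coeff_mk, coeff_mk, coeff_mk,
    ← Finset.card_filter_add_card_filter_not (s := Finset.univ.filter _) (fun l => 1 ∈ l.parts),
    Finset.filter_filter, Finset.filter_filter, card_length_filter_one_mem,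
    card_length_filter_one_notMem]
  split_ifs <;> simp

theorem lengthSeries_eq (k : ℕ) : lengthSeries k = X ^ k * geomProd 1 k := by
  induction k with
  | zero =>
    rw [geomProd_of_lt zero_lt_one, pow_zero, mul_one]
    ext n
    rw [lengthSeries, coeff_mk, coeff_one]
    split_ifs with h
    · subst h
      simp
    · rw [Nat.cast_eq_zero, Finset.card_eq_zero, Finset.filter_eq_empty_iff]
      intro l _ hl
      have := l.parts_sum
      rw [Multiset.card_eq_zero.1 hl, Multiset.sum_zero] at this
      omega
  | succ k ih =>
    rw [geomProd_succ_right (by omega)]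
    have h1 := lengthSeries_succ k
    have h2 := geomSeries_mul_one_sub (Nat.le_add_left 1 k)
    rw [ih] at h1
    linear_combination geomSeries (k + 1) * h1 - lengthSeries (k + 1) * h2

theorem Nat.Partition.card_parts_le {n : ℕ} (l : n.Partition) : l.parts.card ≤ n := by
  have h := Multiset.card_nsmul_le_sum (s := l.parts) (a := 1) fun i hi => l.parts_pos hi
  rwa [l.parts_sum, smul_eq_mul, mul_one] at h

end PartitionsByLength

/-! ### From the `pd`-crank to coefficients of q-series. -/

section Counting
open PowerSeries

theorem card_betaPartitions (n : ℕ) :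
    Fintype.card {β : Nat.Partition n //
      ∀ i ∈ β.parts, ¬ (i : ℤ) ≡ 1 [ZMOD 6] ∧ ¬ (i : ℤ) ≡ -1 [ZMOD 6]} =
      (Nat.Partition.restricted n IsBetaPart).card := by
  rw [Fintype.card_subtype, Nat.Partition.restricted]
  congr 1

theorem sum_vectorPartition_length (k n : ℕ) :
    (∑ v : VectorPartition n, if v.alphaParts.card = k then (1 : ℤ) else 0) =
      coeff n (lengthSeries k * restrictedSeries IsBetaPart) := by
  rw [Fintype.sum_sigma, coeff_mul, ← Finset.sum_coe_sort (Finset.HasAntidiagonal.antidiagonal n)]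
  refine Finset.sum_congr rfl fun s _ => ?_
  rw [Fintype.sum_prod_type, lengthSeries, restrictedSeries, coeff_mk, coeff_mk,
    ← card_betaPartitions, Finset.card_filter, Nat.cast_sum, Finset.sum_mul]
  refine Finset.sum_congr rfl fun α _ => ?_
  refine (Finset.sum_const (if α.parts.card = k then (1 : ℤ) else 0)).trans ?_
  rw [nsmul_eq_mul, mul_comm, Finset.card_univ]
  simp

/-- The summation index k of `crankSum` is the number of parts of α₂, so that α₁ has m + k parts;
the two components β contribute the square. -/
theorem Mbd_eq_coeff (Δ : ∀ k : ℕ, DesignatedPartition k ≃ VectorPartition k) (m n : ℕ) :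
    (Mbd Δ m n : ℤ) = coeff n (crankSum m (n + 1) * restrictedSeries IsBetaPart ^ 2) := by
  have h1 : (Mbd Δ m n : ℤ) =
      ∑ s : Finset.HasAntidiagonal.antidiagonal n, ∑ v : VectorPartition (s : ℕ × ℕ).1 ×
        VectorPartition (s : ℕ × ℕ).2,
        if (v.1.alphaParts.card : ℤ) - (v.2.alphaParts.card : ℤ) = m then (1 : ℤ) else 0 := by
    rw [Mbd, Fintype.card_subtype, Finset.card_filter, Nat.cast_sum, Fintype.sum_sigma]
    refine Finset.sum_congr rfl fun s _ => ?_
    rw [← Equiv.sum_comp ((Δ (s : ℕ × ℕ).1).prodCongr (Δ (s : ℕ × ℕ).2))]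
    refine Finset.sum_congr rfl fun p _ => ?_
    rw [Nat.cast_ite, Nat.cast_one, Nat.cast_zero]
    rfl
  have h2 : crankSum m (n + 1) * restrictedSeries IsBetaPart ^ 2 =
      ∑ k ∈ Finset.range (n + 1), (lengthSeries (m + k) * restrictedSeries IsBetaPart) *
        (lengthSeries k * restrictedSeries IsBetaPart) := by
    rw [crankSum, Finset.sum_mul]
    refine Finset.sum_congr rfl fun k _ => ?_
    rw [lengthSeries_eq, lengthSeries_eq]
    ring
  rw [h1, h2, map_sum]
  simp only [coeff_mul n (lengthSeries _ * restrictedSeries IsBetaPart)]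
  rw [Finset.sum_comm, ← Finset.sum_coe_sort (Finset.HasAntidiagonal.antidiagonal n)]
  refine Finset.sum_congr rfl fun s _ => ?_
  simp only [← sum_vectorPartition_length, Finset.sum_mul_sum, Fintype.sum_prod_type]
  conv_rhs => rw [Finset.sum_comm]
  refine Finset.sum_congr rfl fun v _ => ?_
  conv_rhs => rw [Finset.sum_comm]
  refine Finset.sum_congr rfl fun w _ => ?_
  have hw : w.alphaParts.card ≤ n := by
    have h1 : w.alphaParts.card ≤ (w.1 : ℕ × ℕ).1 := w.2.1.card_parts_le
    have h2 := Finset.HasAntidiagonal.mem_antidiagonal.1 w.1.2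
    have h3 := Finset.HasAntidiagonal.mem_antidiagonal.1 s.2
    omega
  -- The truncation at n + 1 loses nothing, since a partition of at most n has at most n parts.
  rw [Finset.sum_eq_single_of_mem w.alphaParts.card (Finset.mem_range.2 (by omega))]
  · by_cases h : v.alphaParts.card = m + w.alphaParts.card
    · simp [h]
    · rw [if_neg h, if_neg (by omega), zero_mul]
  · intro k _ hk
    rw [if_neg (Ne.symm hk), mul_zero]

theorem Mbd_neg (Δ : ∀ k : ℕ, DesignatedPartition k ≃ VectorPartition k) (m : ℤ) (n : ℕ) :
    Mbd Δ (-m) n = Mbd Δ m n := by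
  let e : DesignatedBipartition n → DesignatedBipartition n := fun π =>
    ⟨⟨((π.1 : ℕ × ℕ).2, (π.1 : ℕ × ℕ).1), by
      have := Finset.HasAntidiagonal.mem_antidiagonal.1 π.1.2
      rw [Finset.HasAntidiagonal.mem_antidiagonal]
      omega⟩, π.2.2, π.2.1⟩
  have he : Function.Involutive e := fun _ => rfl
  have hc : ∀ π, pdCrank Δ (e π) = - pdCrank Δ π := fun π => by
    simp [e, pdCrank]
  refine Fintype.card_congr (he.toPerm.subtypeEquiv fun π => ?_)
  rw [Function.Involutive.coe_toPerm, hc]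
  omega

theorem Mbd_succ_le (Δ : ∀ k : ℕ, DesignatedPartition k ≃ VectorPartition k) {n : ℕ}
    (h1 : n ≠ 1) (h5 : n ≠ 5) (h7 : n ≠ 7) (m : ℕ) :
    Mbd Δ ((m + 1 : ℕ) : ℤ) n ≤ Mbd Δ (m : ℤ) n := by
  have hbeta := (coeffNonneg_restrictedSeries IsBetaPart).pow 2
  have key : ∀ f : PowerSeries ℤ, X ^ (n + 1) ∣ crankSum m (n + 1) - crankSum (m + 1) (n + 1) - f →
      0 ≤ coeff n (f * restrictedSeries IsBetaPart ^ 2) →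
      Mbd Δ ((m + 1 : ℕ) : ℤ) n ≤ Mbd Δ (m : ℤ) n := by
    intro f hf h0
    have h := X_pow_dvd_iff.1 (Dvd.dvd.mul_right hf (restrictedSeries IsBetaPart ^ 2)) n
      (Nat.lt_succ_self n)
    rw [sub_mul, sub_mul, map_sub, map_sub, ← Mbd_eq_coeff Δ, ← Mbd_eq_coeff Δ] at h
    omega
  rcases Nat.eq_zero_or_pos m with rfl | hm
  · rcases Nat.eq_zero_or_pos n with rfl | hn
    -- The expansion for m = 0 requires truncation order at least 2, so n = 0 is done by hand:
    -- modulo X the difference is 1 - 0.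
    · refine key (1 - 0) ?_ (hbeta.mul CoeffNonneg.one |> fun h => by simpa [mul_comm] using h 0)
      simp [crankSum, geomProd_of_lt]
    · obtain ⟨f, hf, hd⟩ := exists_coeffNonneg_crankSum_zero (N := n + 1) (by omega)
      refine key _ hd ?_
      -- Outside degrees 1, 5, 7 the correction X + X⁵ + X⁷ has coefficient zero.
      have hs := coeffNonneg_mul_betaSeries_sq n
      rw [map_add, map_add, map_add, coeff_X, coeff_X_pow, coeff_X_pow, if_neg h1, if_neg h5,
        if_neg h7] at hs
      have hfn := (hf.mul hbeta) n
      rw [add_mul, map_add]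
      linarith
  · obtain ⟨f, hf, hd⟩ := exists_coeffNonneg_crankSum_sub hm (n + 1)
    exact key _ hd ((hf.mul hbeta) n)

end Counting

theorem mainTheorem2 (Δ : ∀ k : ℕ, DesignatedPartition k ≃ VectorPartition k)
    (n : ℕ) (h1 : n ≠ 1) (h5 : n ≠ 5) (h7 : n ≠ 7) :
    (∀ m : ℤ, Mbd Δ (-m) n = Mbd Δ m n) ∧
    MonotoneOn (fun m : ℤ => Mbd Δ m n) (Set.Icc (-(n : ℤ)) 0) ∧
    AntitoneOn (fun m : ℤ => Mbd Δ m n) (Set.Icc 0 (n : ℤ)) := by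
  have hanti : ∀ a b : ℤ, 0 ≤ a → a ≤ b → Mbd Δ b n ≤ Mbd Δ a n := by
    intro a b ha hab
    lift a to ℕ using ha
    lift b to ℕ using by omega
    exact antitone_nat_of_succ_le (f := fun m : ℕ => Mbd Δ (m : ℤ) n)
      (Mbd_succ_le Δ h1 h5 h7) (Int.ofNat_le.1 hab)
  refine ⟨fun m => Mbd_neg Δ m n, fun a _ b hb hab => ?_, fun a ha b _ hab => hanti a b ha.1 hab⟩
  have h := hanti (-b) (-a) (by have := hb.2; omega) (by omega)
  simpa only [Mbd_neg] using h
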